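/- Let $\Bbbk$ be a field and let $H$ be a bialgebra over $\Bbbk$. For a coalgebra $C$ over $\Bbbk$, let $\mathfrak{M}^C$ denote the $\Bbbk$-linear category of right $C$-comodules. A left $H$-module coalgebra is a coalgebra $C$ in the monoidal category of left $H$-modules, i.e. a coalgebra with a left $H$-module structure such that $\Delta(hc)=h_{(1)}c_{(1)}\otimes h_{(2)}c_{(2)}$ and $\varepsilon(hc)=\varepsilon(h)\varepsilon(c)$. For such $C$, the monoidal category $\mathfrak{M}^H$ acts on $\mathfrak{M}^C$ from the left: for $X\in\mathfrak{M}^H$ and $M\in\mathfrak{M}^C$, the vector space $X\otimes M$ has the coaction $x\otimes m\mapsto x_{(0)}\otimes m_{(0)}\otimes x_{(1)}m_{(1)}$. For left $H$-module coalgebras $C$ and $D$, a lax left $\mathfrak{M}^H$-module functor $\mathfrak{M}^C\to\mathfrak{M}^D$ is a functor $F$ with a natural transformation $\xi_{X,M}:X\otimes F(M)\to F(X\otimes M)$ ($X\in\mathfrak{M}^H$, $M\in\mathfrak{M}^C$) satisfying, up to the canonical associativity and unit isomorphisms, $\xi_{X\otimes Y,M}=\xi_{X,Y\otimes M}\circ(\mathrm{id}_X\otimes\xi_{Y,M})$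 and $\xi_{\mathbf 1,M}=\mathrm{id}_{F(M)}$; it is strong if every $\xi_{X,M}$ is invertible. A functor is of type $\mathscr{L}$ if it is $\Bbbk$-linear, left exact and preserves small coproducts. Let $\mathscr{L}^{\mathrm{lax}}_{\mathfrak{M}^H}(\mathfrak{M}^C,\mathfrak{M}^D)$ be the category of lax left $\mathfrak{M}^H$-module functors $\mathfrak{M}^C\to\mathfrak{M}^D$ whose underlying functor is of type $\mathscr{L}$, with the natural transformations compatible with the structure morphisms $\xi$ as morphisms; let $\mathscr{L}^{\mathrm{strong}}_{\mathfrak{M}^H}(\mathfrak{M}^C,\mathfrak{M}^D)$ be its full subcategory of strong module functors, and $i_{C,D}:\mathscr{L}^{\mathrm{strong}}_{\mathfrak{M}^H}(\mathfrak{M}^C,\mathfrak{M}^D)\to\mathscr{L}^{\mathrm{lax}}_{\mathfrak{M}^H}(\mathfrak{M}^C,\mathfrak{M}^D)$ the inclusion functor. Let ${}^C_H\mathfrak{M}^D$ be the category of $C$-$D$-bicomodules in the monoidal category of left $H$-modules, i.e. left $H$-modules $M$ with a $C$-$D$-bicomodule structure such that $h m\mapsto h_{(1)}m_{(-1)}\otimes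 h_{(2)}m_{(0)}$ under the left coaction and $h m\mapsto h_{(1)}m_{(0)}\otimes h_{(2)}m_{(1)}$ under the right coaction. Then the following are equivalent: 1. $H$ is a Hopf algebra, that is, it has an antipode. 2. $i_{C,D}$ is an equivalence for all left $H$-module coalgebras $C$ and $D$. 3. There exist left $H$-module coalgebras $C$ and $D$ such that $i_{C,D}$ is an equivalence, $C\neq 0$, and the vector space $C\otimes H$, with the left $C$-coaction $\Delta_C\otimes\mathrm{id}_H$, the diagonal left $H$-action $h(c\otimes h')=h_{(1)}c\otimes h_{(2)}h'$ and some right $D$-coaction, is an object of ${}^C_H\mathfrak{M}^D$. -/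

import Mathlib

open CategoryTheory CategoryTheory.Limits MonoidalCategory
open scoped TensorProduct MonoidalLeftAction

universe u

namespace LaxStrong

noncomputable section

section Comodules

variable (k : Type u) [Field k] (C : Type u) [AddCommGroup C] [Module k C] [Coalgebra k C]

/-- A right comodule over the `k`-coalgebra `C`: a `k`-vector space with a coassociative and
counital linear map `coact : M → M ⊗ C`. -/
structure RComod where
  carrier : Type u
  [addCommGroup : AddCommGroup carrier]
  [module : Module k carrier]
  coact : carrier →ₗ[k] carrier ⊗[k] C
  coassoc : ∀ m : carrier,
    TensorProduct.assoc k carrier C C (coact.rTensor C (coact m)) =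
      (Coalgebra.comul (R := k) (A := C)).lTensor carrier (coact m)
  counit_coact : ∀ m : carrier,
    TensorProduct.rid k carrier
      ((Coalgebra.counit (R := k) (A := C)).lTensor carrier (coact m)) = m

attribute [instance] RComod.addCommGroup RComod.module

end Comodules

namespace RComod

variable {k : Type u} [Field k] {C : Type u} [AddCommGroup C] [Module k C] [Coalgebra k C]

/-- A morphism of right comodules: a linear map commuting with the coactions. -/
@[ext]
structure Hom (M N : RComod k C) where
  lin : M.carrier →ₗ[k] N.carrier
  comm : ∀ m : M.carrier, N.coact (lin m) = lin.rTensor C (M.coact m)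

/-- The category of right `C`-comodules. -/
instance : Category (RComod k C) where
  Hom M N := Hom M N
  id M := ⟨LinearMap.id, fun m => by simp⟩
  comp f g := ⟨g.lin ∘ₗ f.lin, fun m => by
    rw [LinearMap.comp_apply, g.comm, f.comm, LinearMap.rTensor_comp_apply]⟩

@[ext]
theorem hom_ext {M N : RComod k C} {f g : M ⟶ N} (h : f.lin = g.lin) : f = g :=
  Hom.ext h

@[simp] theorem id_lin (M : RComod k C) : Hom.lin (𝟙 M) = LinearMap.id := rfl

@[simp] theorem comp_lin {M N P : RComod k C} (f : M ⟶ N) (g : N ⟶ P) :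
    (f ≫ g).lin = g.lin ∘ₗ f.lin := rfl

/-- The space of comodule maps, as a subspace of the space of linear maps. -/
def homSubmodule (M N : RComod k C) : Submodule k (M.carrier →ₗ[k] N.carrier) where
  carrier := {f | ∀ m : M.carrier, N.coact (f m) = f.rTensor C (M.coact m)}
  add_mem' := by
    intro f g hf hg m
    simp [LinearMap.rTensor_add, hf m, hg m]
  zero_mem' := by
    intro m
    simp
  smul_mem' := by
    intro c f hf m
    simp [LinearMap.rTensor_smul, hf m]

def homEquiv (M N : RComod k C) : (M ⟶ N) ≃ homSubmodule M N where
  toFun f := ⟨f.lin, f.comm⟩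
  invFun f := ⟨f.1, f.2⟩

instance (M N : RComod k C) : AddCommGroup (M ⟶ N) := (homEquiv M N).addCommGroup

instance (M N : RComod k C) : Module k (M ⟶ N) := (homEquiv M N).module k

@[simp] theorem add_lin {M N : RComod k C} (f g : M ⟶ N) : (f + g).lin = f.lin + g.lin := rfl

@[simp] theorem smul_lin {M N : RComod k C} (c : k) (f : M ⟶ N) : (c • f).lin = c • f.lin := rfl

instance : Preadditive (RComod k C) where
  add_comp _ _ _ _ _ _ := by
    ext x
    simp
  comp_add _ _ _ _ _ _ := by
    ext x
    simp

/-- The `k`-linear structure of the category of right `C`-comodules. -/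
instance : Linear k (RComod k C) where
  smul_comp _ _ _ _ _ _ := by
    ext x
    simp
  comp_smul _ _ _ _ _ _ := by
    ext x
    simp

/-- A linear isomorphism commuting with the coactions is an isomorphism of comodules. -/
def mkIso {M N : RComod k C} (e : M.carrier ≃ₗ[k] N.carrier)
    (he : ∀ m : M.carrier, N.coact (e m) = e.toLinearMap.rTensor C (M.coact m)) : M ≅ N where
  hom := ⟨e.toLinearMap, he⟩
  inv := ⟨e.symm.toLinearMap, fun n => by
    obtain ⟨m, rfl⟩ := e.surjective n
    rw [he m, ← LinearMap.rTensor_comp_apply]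
    simp⟩
  hom_inv_id := by
    ext x
    exact e.symm_apply_apply x
  inv_hom_id := by
    ext x
    exact e.apply_symm_apply x

end RComod

section Actions

variable {k : Type u} [Field k] {H : Type u} [Ring H] [Bialgebra k H]

/-- The diagonal action `h (m ⊗ n) = h₍₁₎ m ⊗ h₍₂₎ n` built from linear actions
`a : H ⊗ M → M` and `b : H ⊗ N → N`. -/
def diagAct {M N : Type u} [AddCommGroup M] [Module k M] [AddCommGroup N] [Module k N]
    (a : H ⊗[k] M →ₗ[k] M) (b : H ⊗[k] N →ₗ[k] N) :
    H ⊗[k] (M ⊗[k] N) →ₗ[k] M ⊗[k] N :=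
  TensorProduct.map a b ∘ₗ
    (TensorProduct.tensorTensorTensorComm k H H M N).toLinearMap ∘ₗ
      (Coalgebra.comul (R := k) (A := H)).rTensor (M ⊗[k] N)

variable (k H)

/-- The action map `H ⊗ M → M`, `h ⊗ m ↦ h m`, of an `H`-module `M`. -/
def actMap (M : Type u) [AddCommGroup M] [Module k M] [Module H M] [IsScalarTower k H M] :
    H ⊗[k] M →ₗ[k] M :=
  TensorProduct.lift (Algebra.lsmul k k M).toLinearMap

@[simp] theorem actMap_tmul (M : Type u) [AddCommGroup M] [Module k M] [Module H M]
    [IsScalarTower k H M] (h : H) (m : M) : actMap k H M (h ⊗ₜ m) = h • m := rfl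

/-- `C`, a coalgebra and a left `H`-module, is a left `H`-module coalgebra: comultiplication and
counit are `H`-linear, where `H` acts diagonally on `C ⊗ C` and through the counit on `k`. -/
class IsModuleCoalgebra (C : Type u) [AddCommGroup C] [Module k C] [Module H C]
    [IsScalarTower k H C] [Coalgebra k C] : Prop where
  comul_smul : ∀ (h : H) (c : C), Coalgebra.comul (R := k) (h • c) =
    diagAct (actMap k H C) (actMap k H C) (h ⊗ₜ[k] Coalgebra.comul (R := k) c)
  counit_smul : ∀ (h : H) (c : C), Coalgebra.counit (R := k) (h • c) =
    Coalgebra.counit (R := k) h * Coalgebra.counit (R := k) c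

/-- `H` is a left module coalgebra over itself by multiplication. -/
instance isModuleCoalgebraSelf : IsModuleCoalgebra k H H where
  comul_smul h c := by
    rw [smul_eq_mul, Bialgebra.comul_mul]
    simp only [diagAct, LinearMap.comp_apply, LinearMap.rTensor_tmul]
    generalize Coalgebra.comul (R := k) h = u
    generalize Coalgebra.comul (R := k) c = v
    induction u with
    | zero => simp
    | add x y hx hy => simp [add_mul, TensorProduct.add_tmul, hx, hy]
    | tmul a b =>
      induction v with
      | zero => simp
      | add x y hx hy => simp [mul_add, TensorProduct.tmul_add, hx, hy]
      | tmul c d => simp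
  counit_smul h c := by simp

end Actions

namespace RComod

variable {k : Type u} [Field k] {H : Type u} [Ring H] [Bialgebra k H]
  {C : Type u} [AddCommGroup C] [Module k C] [Module H C] [IsScalarTower k H C] [Coalgebra k C]

/-- The coaction `x ⊗ m ↦ (x₍₀₎ ⊗ m₍₀₎) ⊗ x₍₁₎ m₍₁₎` on `X ⊗ M`. -/
def tensCoact (X : RComod k H) (M : RComod k C) :
    X.carrier ⊗[k] M.carrier →ₗ[k] (X.carrier ⊗[k] M.carrier) ⊗[k] C :=
  (actMap k H C).lTensor (X.carrier ⊗[k] M.carrier) ∘ₗ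
    (TensorProduct.tensorTensorTensorComm k X.carrier H M.carrier C).toLinearMap ∘ₗ
      TensorProduct.map X.coact M.coact

theorem tensCoact_tmul (X : RComod k H) (M : RComod k C) (x : X.carrier) (m : M.carrier) :
    tensCoact X M (x ⊗ₜ m) = (actMap k H C).lTensor (X.carrier ⊗[k] M.carrier)
      (TensorProduct.tensorTensorTensorComm k X.carrier H M.carrier C
        (X.coact x ⊗ₜ M.coact m)) := rfl

section Tens

variable [IsModuleCoalgebra k H C]

/-- The right `C`-comodule `X ⊗ M` for `X` a right `H`-comodule and `M` a right `C`-comodule. -/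
@[reducible] def tens (X : RComod k H) (M : RComod k C) : RComod k C where
  carrier := X.carrier ⊗[k] M.carrier
  coact := tensCoact X M
  coassoc t := by
    let Ψ := (TensorProduct.map (actMap k H C) (actMap k H C) ∘ₗ
      (TensorProduct.tensorTensorTensorComm k H H C C).toLinearMap).lTensor
        (X.carrier ⊗[k] M.carrier) ∘ₗ
      (TensorProduct.tensorTensorTensorComm k X.carrier (H ⊗[k] H) M.carrier
        (C ⊗[k] C)).toLinearMap
    have h1 : ∀ (u : X.carrier ⊗[k] H) (v : M.carrier ⊗[k] C),
        TensorProduct.assoc k _ C C ((tensCoact X M).rTensor C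
          ((actMap k H C).lTensor (X.carrier ⊗[k] M.carrier)
            (TensorProduct.tensorTensorTensorComm k X.carrier H M.carrier C (u ⊗ₜ v)))) =
        Ψ (TensorProduct.assoc k _ H H (X.coact.rTensor H u) ⊗ₜ
          TensorProduct.assoc k _ C C (M.coact.rTensor C v)) := by
      intro u v
      induction u with
      | zero => simp
      | add x y hx hy => simp only [TensorProduct.add_tmul, map_add, hx, hy]
      | tmul x h =>
        induction v with
        | zero => simp
        | add x y hx hy => simp only [TensorProduct.tmul_add, map_add, hx, hy]
        | tmul m c =>
          simp only [TensorProduct.tensorTensorTensorComm_tmul, LinearMap.lTensor_tmul,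
            LinearMap.rTensor_tmul, tensCoact_tmul, actMap_tmul]
          generalize X.coact x = u
          generalize M.coact m = v
          induction u with
          | zero => simp
          | add x y hx hy => simp only [TensorProduct.add_tmul, map_add, hx, hy]
          | tmul x h =>
            induction v with
            | zero => simp
            | add x y hx hy =>
              simp only [TensorProduct.tmul_add, TensorProduct.add_tmul, map_add, hx, hy]
            | tmul m c => simp [Ψ]
    have h2 : ∀ (u : X.carrier ⊗[k] H) (v : M.carrier ⊗[k] C),
        (Coalgebra.comul (R := k) (A := C)).lTensor _
          ((actMap k H C).lTensor (X.carrier ⊗[k] M.carrier)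
            (TensorProduct.tensorTensorTensorComm k X.carrier H M.carrier C (u ⊗ₜ v))) =
        Ψ ((Coalgebra.comul (R := k) (A := H)).lTensor _ u ⊗ₜ
          (Coalgebra.comul (R := k) (A := C)).lTensor _ v) := by
      intro u v
      induction u with
      | zero => simp
      | add x y hx hy => simp only [TensorProduct.add_tmul, map_add, hx, hy]
      | tmul x h =>
        induction v with
        | zero => simp
        | add x y hx hy => simp only [TensorProduct.tmul_add, map_add, hx, hy]
        | tmul m c => simp [Ψ, IsModuleCoalgebra.comul_smul, diagAct]
    induction t with
    | zero => simp
    | add x y hx hy => simp only [map_add, hx, hy]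
    | tmul x m =>
      rw [tensCoact_tmul, h1, h2, X.coassoc, M.coassoc]
  counit_coact t := by
    have h : ∀ (u : X.carrier ⊗[k] H) (v : M.carrier ⊗[k] C),
        TensorProduct.rid k _ ((Coalgebra.counit (R := k) (A := C)).lTensor _
          ((actMap k H C).lTensor (X.carrier ⊗[k] M.carrier)
            (TensorProduct.tensorTensorTensorComm k X.carrier H M.carrier C (u ⊗ₜ v)))) =
        TensorProduct.rid k _ ((Coalgebra.counit (R := k) (A := H)).lTensor _ u) ⊗ₜ
          TensorProduct.rid k _ ((Coalgebra.counit (R := k) (A := C)).lTensor _ v) := by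
      intro u v
      induction u with
      | zero => simp
      | add x y hx hy => simp only [TensorProduct.add_tmul, map_add, hx, hy]
      | tmul x h =>
        induction v with
        | zero => simp
        | add x y hx hy => simp only [TensorProduct.tmul_add, map_add, hx, hy]
        | tmul m c =>
          simp [IsModuleCoalgebra.counit_smul, TensorProduct.smul_tmul', smul_smul, mul_comm]
    induction t with
    | zero => simp
    | add x y hx hy => simp only [map_add, hx, hy]
    | tmul x m =>
      rw [tensCoact_tmul, h, X.counit_coact, M.counit_coact]

/-- The tensor product of morphisms. -/
def tensHom {X Y : RComod k H} {M N : RComod k C} (f : X ⟶ Y) (g : M ⟶ N) :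
    tens X M ⟶ tens Y N where
  lin := TensorProduct.map f.lin g.lin
  comm t := by
    have h : ∀ (u : X.carrier ⊗[k] H) (v : M.carrier ⊗[k] C),
        (actMap k H C).lTensor (Y.carrier ⊗[k] N.carrier)
          (TensorProduct.tensorTensorTensorComm k Y.carrier H N.carrier C
            (f.lin.rTensor H u ⊗ₜ g.lin.rTensor C v)) =
        (TensorProduct.map f.lin g.lin).rTensor C
          ((actMap k H C).lTensor (X.carrier ⊗[k] M.carrier)
            (TensorProduct.tensorTensorTensorComm k X.carrier H M.carrier C (u ⊗ₜ v))) := by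
      intro u v
      induction u with
      | zero => simp
      | add x y hx hy => simp only [TensorProduct.add_tmul, map_add, hx, hy]
      | tmul x h =>
        induction v with
        | zero => simp
        | add x y hx hy => simp only [TensorProduct.tmul_add, map_add, hx, hy]
        | tmul m c => simp
    have h' : ∀ t : X.carrier ⊗[k] M.carrier,
        tensCoact Y N (TensorProduct.map f.lin g.lin t) =
          (TensorProduct.map f.lin g.lin).rTensor C (tensCoact X M t) := by
      intro t
      induction t with
      | zero => simp
      | add x y hx hy => simp only [map_add, hx, hy]
      | tmul x m =>
        rw [TensorProduct.map_tmul, tensCoact_tmul, tensCoact_tmul, f.comm, g.comm, h]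
    exact h' t

@[simp] theorem tensHom_lin {X Y : RComod k H} {M N : RComod k C} (f : X ⟶ Y) (g : M ⟶ N) :
    (tensHom f g).lin = TensorProduct.map f.lin g.lin := rfl

/-- The associativity isomorphism `(X ⊗ Y) ⊗ M ≅ X ⊗ (Y ⊗ M)`. -/
def tensAssoc (X Y : RComod k H) (M : RComod k C) : tens (tens X Y) M ≅ tens X (tens Y M) :=
  mkIso (TensorProduct.assoc k X.carrier Y.carrier M.carrier) (fun t => by
    have h : ∀ (u : X.carrier ⊗[k] H) (v : Y.carrier ⊗[k] H) (w : M.carrier ⊗[k] C),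
        (actMap k H C).lTensor (X.carrier ⊗[k] (Y.carrier ⊗[k] M.carrier))
          (TensorProduct.tensorTensorTensorComm k X.carrier H (Y.carrier ⊗[k] M.carrier) C
            (u ⊗ₜ (actMap k H C).lTensor (Y.carrier ⊗[k] M.carrier)
              (TensorProduct.tensorTensorTensorComm k Y.carrier H M.carrier C (v ⊗ₜ w)))) =
        (TensorProduct.assoc k X.carrier Y.carrier M.carrier).toLinearMap.rTensor C
          ((actMap k H C).lTensor ((X.carrier ⊗[k] Y.carrier) ⊗[k] M.carrier)
            (TensorProduct.tensorTensorTensorComm k (X.carrier ⊗[k] Y.carrier) H M.carrier C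
              ((actMap k H H).lTensor (X.carrier ⊗[k] Y.carrier)
                (TensorProduct.tensorTensorTensorComm k X.carrier H Y.carrier H (u ⊗ₜ v)) ⊗ₜ
                  w))) := by
      intro u v w
      induction u with
      | zero => simp
      | add x y hx hy => simp only [TensorProduct.add_tmul, map_add, hx, hy]
      | tmul x h =>
        induction v with
        | zero => simp
        | add x y hx hy =>
          simp only [TensorProduct.tmul_add, TensorProduct.add_tmul, map_add, hx, hy]
        | tmul y h' =>
          induction w with
          | zero => simp
          | add x y hx hy => simp only [TensorProduct.tmul_add, map_add, hx, hy]
          | tmul m c => simp [mul_smul]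
    have h' : ∀ t : (X.carrier ⊗[k] Y.carrier) ⊗[k] M.carrier,
        tensCoact X (tens Y M) (TensorProduct.assoc k X.carrier Y.carrier M.carrier t) =
        (TensorProduct.assoc k X.carrier Y.carrier M.carrier).toLinearMap.rTensor C
          (tensCoact (tens X Y) M t) := by
      intro t
      induction t with
      | zero => simp
      | add x y hx hy => simp only [map_add, hx, hy]
      | tmul xy m =>
        induction xy with
        | zero => simp
        | add x y hx hy => simp only [TensorProduct.add_tmul, map_add, hx, hy]
        | tmul x y => exact h (X.coact x) (Y.coact y) (M.coact m)
    exact h' t)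

@[simp] theorem tensAssoc_hom_lin (X Y : RComod k H) (M : RComod k C) :
    (tensAssoc X Y M).hom.lin =
      (TensorProduct.assoc k X.carrier Y.carrier M.carrier).toLinearMap := rfl

@[simp] theorem tensAssoc_inv_lin (X Y : RComod k H) (M : RComod k C) :
    (tensAssoc X Y M).inv.lin =
      (TensorProduct.assoc k X.carrier Y.carrier M.carrier).symm.toLinearMap := rfl

end Tens

variable (k H) in
/-- The unit object: `k` with the coaction `r ↦ r ⊗ 1`. -/
@[reducible] def unit : RComod k H where
  carrier := k
  coact := (TensorProduct.mk k k H).flip 1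
  coassoc r := by
    simp [Algebra.TensorProduct.one_def]
  counit_coact r := by
    simp

section Tens

variable [IsModuleCoalgebra k H C]

/-- The unit isomorphism `k ⊗ M ≅ M`. -/
def tensUnit (M : RComod k C) : tens (unit k H) M ≅ M :=
  mkIso (TensorProduct.lid k M.carrier) (fun t => by
    have h : ∀ (r : k) (v : M.carrier ⊗[k] C),
        r • v = (TensorProduct.lid k M.carrier).toLinearMap.rTensor C
          ((actMap k H C).lTensor (k ⊗[k] M.carrier)
            (TensorProduct.tensorTensorTensorComm k k H M.carrier C
              ((r ⊗ₜ[k] (1 : H)) ⊗ₜ[k] v))) := by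
      intro r v
      induction v with
      | zero => simp
      | add x y hx hy => simp only [TensorProduct.tmul_add, map_add, smul_add, hx, hy]
      | tmul m c => simp [TensorProduct.smul_tmul']
    have h' : ∀ t : k ⊗[k] M.carrier, M.coact (TensorProduct.lid k M.carrier t) =
        (TensorProduct.lid k M.carrier).toLinearMap.rTensor C (tensCoact (unit k H) M t) := by
      intro t
      induction t with
      | zero => simp
      | add x y hx hy => simp only [map_add, hx, hy]
      | tmul r m =>
        rw [TensorProduct.lid_tmul, map_smul]
        exact h r (M.coact m)
    exact h' t)

@[simp] theorem tensUnit_hom_lin (M : RComod k C) :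
    (tensUnit (H := H) M).hom.lin = (TensorProduct.lid k M.carrier).toLinearMap := rfl

@[simp] theorem tensUnit_inv_lin (M : RComod k C) :
    (tensUnit (H := H) M).inv.lin = (TensorProduct.lid k M.carrier).symm.toLinearMap := rfl

end Tens

/-- The unit isomorphism `X ⊗ k ≅ X`. -/
def tensUnitRight (X : RComod k H) : tens X (unit k H) ≅ X :=
  mkIso (TensorProduct.rid k X.carrier) (fun t => by
    have h : ∀ (r : k) (v : X.carrier ⊗[k] H),
        r • v = (TensorProduct.rid k X.carrier).toLinearMap.rTensor H
          ((actMap k H H).lTensor (X.carrier ⊗[k] k)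
            (TensorProduct.tensorTensorTensorComm k X.carrier H k H
              (v ⊗ₜ[k] (r ⊗ₜ[k] (1 : H))))) := by
      intro r v
      induction v with
      | zero => simp
      | add x y hx hy => simp only [TensorProduct.add_tmul, map_add, smul_add, hx, hy]
      | tmul m c => simp [TensorProduct.smul_tmul']
    have h' : ∀ t : X.carrier ⊗[k] k, X.coact (TensorProduct.rid k X.carrier t) =
        (TensorProduct.rid k X.carrier).toLinearMap.rTensor H (tensCoact X (unit k H) t) := by
      intro t
      induction t with
      | zero => simp
      | add x y hx hy => simp only [map_add, hx, hy]
      | tmul x r =>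
        rw [TensorProduct.rid_tmul, map_smul]
        exact h r (X.coact x)
    exact h' t)

@[simp] theorem tensUnitRight_hom_lin (X : RComod k H) :
    (tensUnitRight X).hom.lin = (TensorProduct.rid k X.carrier).toLinearMap := rfl

/-- The monoidal category of right `H`-comodules. -/
instance : MonoidalCategory (RComod k H) where
  tensorObj X Y := tens X Y
  tensorHom f g := tensHom f g
  whiskerLeft X _ _ g := tensHom (𝟙 X) g
  whiskerRight f Y := tensHom f (𝟙 Y)
  tensorUnit := unit k H
  associator X Y Z := tensAssoc X Y Z
  leftUnitor X := tensUnit X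
  rightUnitor X := tensUnitRight X
  tensorHom_def f g := by
    apply hom_ext
    exact TensorProduct.ext' fun _ _ => rfl
  id_tensorHom_id X Y := by
    apply hom_ext
    exact TensorProduct.ext' fun _ _ => rfl
  tensorHom_comp_tensorHom f g f' g' := by
    apply hom_ext
    exact TensorProduct.ext' fun _ _ => rfl
  whiskerLeft_id X Y := by
    apply hom_ext
    exact TensorProduct.ext' fun _ _ => rfl
  id_whiskerRight X Y := by
    apply hom_ext
    exact TensorProduct.ext' fun _ _ => rfl
  associator_naturality f g h := by
    apply hom_ext
    exact TensorProduct.ext_threefold fun _ _ _ => rfl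
  leftUnitor_naturality f := by
    apply hom_ext
    exact TensorProduct.ext' fun r m => (f.lin.map_smul r m).symm
  rightUnitor_naturality f := by
    apply hom_ext
    exact TensorProduct.ext' fun m r => (map_smul f.lin r m).symm
  pentagon W X Y Z := by
    apply hom_ext
    exact TensorProduct.ext_fourfold fun _ _ _ _ => rfl
  triangle X Y := by
    apply hom_ext
    exact TensorProduct.ext_threefold fun x r y => (TensorProduct.smul_tmul r x y).symm

/-- The left action of the monoidal category of right `H`-comodules on the category of right
`C`-comodules. -/
instance [IsModuleCoalgebra k H C] : MonoidalLeftAction (RComod k H) (RComod k C) where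
  actionObj X M := tens X M
  actionHom f g := tensHom f g
  actionHomRight X _ _ g := tensHom (𝟙 X) g
  actionHomLeft f M := tensHom f (𝟙 M)
  actionAssocIso X Y M := tensAssoc X Y M
  actionUnitIso M := tensUnit M
  actionHom_def f g := by
    apply hom_ext
    exact TensorProduct.ext' fun _ _ => rfl
  actionHomRight_id X Y := by
    apply hom_ext
    exact TensorProduct.ext' fun _ _ => rfl
  id_actionHomLeft X Y := by
    apply hom_ext
    exact TensorProduct.ext' fun _ _ => rfl
  actionHom_comp f g f' g' := by
    apply hom_ext
    exact TensorProduct.ext' fun _ _ => rfl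
  actionAssocIso_hom_naturality f g h := by
    apply hom_ext
    exact TensorProduct.ext_threefold fun _ _ _ => rfl
  actionUnitIso_hom_naturality f := by
    apply hom_ext
    exact TensorProduct.ext' fun r m => map_smul f.lin r m
  whiskerLeft_actionHomLeft c _ _ f d := by
    apply hom_ext
    exact TensorProduct.ext_threefold fun _ _ _ => rfl
  whiskerRight_actionHomLeft c f d := by
    apply hom_ext
    exact TensorProduct.ext_threefold fun _ _ _ => rfl
  associator_actionHom W X Y Z := by
    apply hom_ext
    exact TensorProduct.ext_fourfold fun _ _ _ _ => rfl
  leftUnitor_actionHom X M := by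
    apply hom_ext
    exact TensorProduct.ext_threefold fun r x m => rfl
  rightUnitor_actionHom X M := by
    apply hom_ext
    exact TensorProduct.ext_threefold fun x r m => TensorProduct.smul_tmul r x m

end RComod

/-- The property of having an antipode: the given bialgebra structure underlies a Hopf algebra
structure. -/
def HasAntipode (k : Type u) [Field k] (H : Type u) [Ring H] [B : Bialgebra k H] : Prop :=
  ∃ A : HopfAlgebra k H, A.toBialgebra = B

/-- A left `H`-module coalgebra. -/
structure ModCoalg (k : Type u) [Field k] (H : Type u) [Ring H] [Bialgebra k H] where
  carrier : Type u
  [addCommGroup : AddCommGroup carrier]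
  [module : Module k carrier]
  [hModule : Module H carrier]
  [isScalarTower : IsScalarTower k H carrier]
  [coalgebra : Coalgebra k carrier]
  [isModuleCoalgebra : IsModuleCoalgebra k H carrier]

attribute [instance] ModCoalg.addCommGroup ModCoalg.module ModCoalg.hModule
  ModCoalg.isScalarTower ModCoalg.coalgebra ModCoalg.isModuleCoalgebra

section Functors

/-- A functor between `k`-linear categories is of type `ℒ` if it is linear, left exact and
preserves small coproducts. -/
structure IsTypeL (k : Type u) [Field k] {A B : Type (u + 1)} [Category.{u} A] [Category.{u} B]
    [Preadditive A] [Preadditive B] [Linear k A] [Linear k B] (F : A ⥤ B) : Prop where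
  additive : F.Additive
  linear : F.Linear k
  preservesFiniteLimits : PreservesFiniteLimits F
  preservesCoproducts : ∀ J : Type u, PreservesColimitsOfShape (Discrete J) F

variable {k : Type u} [Field k] {H : Type u} [Ring H] [Bialgebra k H]

/-- A lax left module functor of type `ℒ`, over the monoidal category of right `H`-comodules, from
right `C`-comodules to right `D`-comodules. -/
structure LaxModFunctor (C D : ModCoalg k H) where
  functor : RComod k C.carrier ⥤ RComod k D.carrier
  isTypeL : IsTypeL k functor
  [lax : functor.LaxLeftLinear (RComod k H)]

attribute [instance] LaxModFunctor.lax

namespace LaxModFunctor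

variable {C D : ModCoalg k H}

/-- The structure morphism `X ⊗ F(M) ⟶ F(X ⊗ M)`. -/
abbrev ξ (F : LaxModFunctor C D) (X : RComod k H) (M : RComod k C.carrier) :
    X ⊙ₗ F.functor.obj M ⟶ F.functor.obj (X ⊙ₗ M) :=
  Functor.LaxLeftLinear.μₗ F.functor X M

/-- A morphism of lax module functors: a natural transformation compatible with the structure
morphisms. -/
@[ext]
structure Hom (F G : LaxModFunctor C D) where
  nat : F.functor ⟶ G.functor
  comm : ∀ (X : RComod k H) (M : RComod k C.carrier),
    F.ξ X M ≫ nat.app (X ⊙ₗ M) = X ⊴ₗ nat.app M ≫ G.ξ X M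

/-- The category of lax module functors of type `ℒ`. -/
instance : Category (LaxModFunctor C D) where
  Hom F G := Hom F G
  id F := ⟨𝟙 _, fun X M => by simp⟩
  comp f g := ⟨f.nat ≫ g.nat, fun X M => by
    rw [NatTrans.comp_app, ← Category.assoc, f.comm, Category.assoc, g.comm, NatTrans.comp_app,
      MonoidalLeftAction.actionHomRight_comp, Category.assoc]⟩

end LaxModFunctor

/-- A lax module functor is strong if its structure morphism is invertible. -/
def isStrong (C D : ModCoalg k H) : ObjectProperty (LaxModFunctor C D) :=
  fun F => ∀ (X : RComod k H) (M : RComod k C.carrier), IsIso (F.ξ X M)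

/-- The inclusion of the full subcategory of strong module functors of type `ℒ` into the category
of lax module functors of type `ℒ`. -/
abbrev inclusion (C D : ModCoalg k H) : (isStrong C D).FullSubcategory ⥤ LaxModFunctor C D :=
  (isStrong C D).ι

/-- Given `a : H ⊗ M → M`, `l : M → C ⊗ M` and `r : M → M ⊗ D`, the vector space `M` is a
`C`-`D`-bicomodule in the monoidal category of left `H`-modules with action `a`, left coaction `l`
and right coaction `r`. -/
structure IsEquivariantBicomodule (C D : ModCoalg k H) {M : Type u} [AddCommGroup M] [Module k M]
    (a : H ⊗[k] M →ₗ[k] M) (l : M →ₗ[k] C.carrier ⊗[k] M) (r : M →ₗ[k] M ⊗[k] D.carrier) :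
    Prop where
  one_act : ∀ m : M, a (1 ⊗ₜ m) = m
  mul_act : ∀ (h h' : H) (m : M), a ((h * h') ⊗ₜ m) = a (h ⊗ₜ a (h' ⊗ₜ m))
  left_coassoc : ∀ m : M,
    TensorProduct.assoc k C.carrier C.carrier M
        ((Coalgebra.comul (R := k) (A := C.carrier)).rTensor M (l m)) =
      l.lTensor C.carrier (l m)
  left_counit : ∀ m : M,
    TensorProduct.lid k M ((Coalgebra.counit (R := k) (A := C.carrier)).rTensor M (l m)) = m
  right_coassoc : ∀ m : M,
    TensorProduct.assoc k M D.carrier D.carrier (r.rTensor D.carrier (r m)) =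
      (Coalgebra.comul (R := k) (A := D.carrier)).lTensor M (r m)
  right_counit : ∀ m : M,
    TensorProduct.rid k M ((Coalgebra.counit (R := k) (A := D.carrier)).lTensor M (r m)) = m
  left_right : ∀ m : M,
    TensorProduct.assoc k C.carrier M D.carrier (l.rTensor D.carrier (r m)) =
      r.lTensor C.carrier (l m)
  left_act : ∀ (h : H) (m : M), l (a (h ⊗ₜ m)) = diagAct (actMap k H C.carrier) a (h ⊗ₜ l m)
  right_act : ∀ (h : H) (m : M), r (a (h ⊗ₜ m)) = diagAct a (actMap k H D.carrier) (h ⊗ₜ r m)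

/-- The vector space `C ⊗ H`, with left `C`-coaction `Δ ⊗ id` and the diagonal left `H`-action, is
for some right `D`-coaction a `C`-`D`-bicomodule in the category of left `H`-modules. -/
def TensorIsBicomodule (C D : ModCoalg k H) : Prop :=
  ∃ r : C.carrier ⊗[k] H →ₗ[k] (C.carrier ⊗[k] H) ⊗[k] D.carrier,
    IsEquivariantBicomodule C D (diagAct (actMap k H C.carrier) (actMap k H H))
      ((TensorProduct.assoc k C.carrier C.carrier H).toLinearMap ∘ₗ
        (Coalgebra.comul (R := k) (A := C.carrier)).rTensor H) r

end Functors

end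

end LaxStrong

/-! From an antipode to strength. For a lax module functor `F` of type ℒ, both sides of ξ_{X,M} : X
⊗ F(M) → F(X ⊗ M) are left exact and preserve coproducts in X and in M. Every comodule is an
equalizer of cofree comodules V ⊗ C, and V ⊗ C is a coproduct of copies of C, so ξ is invertible
everywhere once ξ_{H,C} is (`isIso_ξ_of_regular`). Since ξ is invertible at the unit by unitality,
it is also invertible at a space with trivial coaction, which is a coproduct of units
(`isIso_ξ_triv`).

To link H with a trivial comodule, note that C is a module over the algebra H inside comodules,
hence so is F(C). For such a module N, the map H ⊗ N → H_triv ⊗ N, h ⊗ n ↦ h₍₁₎ ⊗ h₍₂₎n, is a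
comodule morphism, with inverse h ⊗ n ↦ h₍₁₎ ⊗ S(h₍₂₎)n when H has an antipode. By naturality and
associativity of ξ these maps for C and F(C) form a commutative square with ξ_{H,C} and ξ_{H_triv,C}
(`ξ_extendHom`). Three of its sides are invertible, so the fourth, ξ_{H,C}, is too. Thus all lax
module functors of type ℒ are strong and the inclusion is an equivalence.

From strength to an antipode. If the inclusion is an equivalence, every lax functor is isomorphic to
a strong one, hence is strong. A bicomodule structure on C ⊗ H is applied through cotensoring, M ↦ M
□_C (C ⊗ H) ≅ M ⊗ H. Concretely, the right coaction is encoded by a map s : C ⊗ H → H ⊗ D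
(`exists_isTwist`), M ⊗ H has coaction m ⊗ h ↦ m₍₀₎ ⊗ s(m₍₁₎ ⊗ h), and the lax structure is x ⊗ m ⊗
h ↦ x₍₀₎ ⊗ m ⊗ x₍₁₎h. Its invertibility at X = H and M = C ≠ 0 forces the Galois map x ⊗ h ↦ x₍₁₎ ⊗
x₍₂₎h to be bijective (`bijective_galoisMap_of_lineator`), and this produces an antipode
(`hasAntipode_of_bijective`).

The bicomodule needed to pass from the second condition to the third is H ⊗ H with C = D = H.

Sweedler computations follow one pattern: a comultiplied element is replaced by an arbitrary tensor,
both sides are written as one linear map applied to the two iterated comultiplications, and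
coassociativity finishes. -/

namespace LaxStrong

noncomputable section

namespace RComod

/-! ### Limits and colimits of comodules through underlying vector spaces -/

section Forget

variable {k : Type u} [Field k] {C : Type u} [AddCommGroup C] [Module k C] [Coalgebra k C]

variable (k C) in
/-- The underlying vector space of a comodule. -/
@[simps]
def forgetComod : RComod k C ⥤ ModuleCat.{u} k where
  obj M := ModuleCat.of k M.carrier
  map f := ModuleCat.ofHom f.lin

variable (k C) in
/-- The coaction, as a natural transformation. -/
@[simps]
def coactNat : forgetComod k C ⟶ forgetComod k C ⋙ tensorRight (ModuleCat.of k C) where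
  app M := ModuleCat.ofHom M.coact
  naturality M N f := by
    ext m
    exact f.comm m

/-- A linear map between comodules, commuting with the coactions, as a morphism. -/
def homOfCommutes {M N : RComod k C}
    (f : (forgetComod k C).obj M ⟶ (forgetComod k C).obj N)
    (hf : f ≫ (coactNat k C).app N = (coactNat k C).app M ≫ f ▷ ModuleCat.of k C) : M ⟶ N where
  lin := f.hom
  comm m := congrArg (fun g => g.hom m) hf

instance : (forgetComod k C).Faithful where
  map_injective {M N f g} h := by
    apply hom_ext
    exact congrArg ModuleCat.Hom.hom h

variable (k C) in
/-- Comultiplication in the category of vector spaces. -/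
def comulArrow : ModuleCat.of k C ⟶ ModuleCat.of k C ⊗ ModuleCat.of k C :=
  ModuleCat.ofHom (Coalgebra.comul (R := k) (A := C))

variable (k C) in
/-- The counit in the category of vector spaces. -/
def counitArrow : ModuleCat.of k C ⟶ 𝟙_ (ModuleCat.{u} k) :=
  ModuleCat.ofHom (Coalgebra.counit (R := k) (A := C))

theorem coactNat_coassoc (M : RComod k C) :
    (coactNat k C).app M ≫ (coactNat k C).app M ▷ ModuleCat.of k C ≫ (α_ _ _ _).hom =
      (coactNat k C).app M ≫ (forgetComod k C).obj M ◁
        comulArrow k C := by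
  ext m
  exact M.coassoc m

theorem coactNat_counit (M : RComod k C) :
    (coactNat k C).app M ≫ (forgetComod k C).obj M ◁
        counitArrow k C ≫ (ρ_ _).hom = 𝟙 _ := by
  ext m
  exact M.counit_coact m

/-- Comodules from arrows in the category of vector spaces. -/
@[simps]
def ofArrow (V : ModuleCat.{u} k) (δ : V ⟶ V ⊗ ModuleCat.of k C)
    (h : δ ≫ δ ▷ ModuleCat.of k C ≫ (α_ _ _ _).hom =
      δ ≫ V ◁ comulArrow k C)
    (h' : δ ≫ V ◁ counitArrow k C ≫ (ρ_ _).hom = 𝟙 _) :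
    RComod k C where
  carrier := V
  coact := δ.hom
  coassoc m := congrArg (fun g => g.hom m) h
  counit_coact m := congrArg (fun g => g.hom m) h'

section Limits

variable {J : Type*} [Category J]

/-- The induced linear map is colinear because two maps out of a colimit are compared on the cocone
legs. Nothing is asked of - ⊗ C, in contrast with limits, where colinearity is an equality of maps
into pt ⊗ C. -/
instance (K : J ⥤ RComod k C) : ReflectsColimit K (forgetComod k C) where
  reflects {c} hc := ⟨{
    desc s := homOfCommutes (hc.desc ((forgetComod k C).mapCocone s)) (by
      refine hc.hom_ext fun j => ?_
      rw [← Category.assoc, hc.fac, ← Category.assoc]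
      dsimp only [Functor.mapCocone_ι_app]
      rw [(coactNat k C).naturality, (coactNat k C).naturality, Category.assoc]
      congr 1
      dsimp only [Functor.comp_map, Functor.flip_obj_map, curriedTensor_map_app]
      change _ = _ ▷ _ ≫ _ ▷ _
      rw [← comp_whiskerRight]
      exact congrArg (· ▷ _) (hc.fac ((forgetComod k C).mapCocone s) j).symm)
    fac s j := (forgetComod k C).map_injective (hc.fac ((forgetComod k C).mapCocone s) j)
    uniq s m hm := (forgetComod k C).map_injective <|
      hc.uniq ((forgetComod k C).mapCocone s) _ fun j =>
        congrArg (forgetComod k C).map (hm j) }⟩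

instance (K : J ⥤ RComod k C)
    [PreservesLimit (K ⋙ forgetComod k C) (tensorRight (ModuleCat.of k C))] :
    ReflectsLimit K (forgetComod k C) where
  reflects {c} hc := ⟨{
    lift s := homOfCommutes (hc.lift ((forgetComod k C).mapCone s)) (by
      refine (isLimitOfPreserves (tensorRight (ModuleCat.of k C)) hc).hom_ext fun j => ?_
      have h1 := (coactNat k C).naturality (c.π.app j)
      have h2 := (coactNat k C).naturality (s.π.app j)
      have h3 := hc.fac ((forgetComod k C).mapCone s) j
      dsimp at h1 h2 h3 ⊢
      rw [Category.assoc, Category.assoc, ← comp_whiskerRight, h3, ← h1, ← h2, ← h3,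
        Category.assoc])
    fac s j := (forgetComod k C).map_injective (hc.fac ((forgetComod k C).mapCone s) j)
    uniq s m hm := (forgetComod k C).map_injective <|
      hc.uniq ((forgetComod k C).mapCone s) _ fun j =>
        congrArg (forgetComod k C).map (hm j) }⟩

variable (K : J ⥤ RComod k C) {c : Cone (K ⋙ forgetComod k C)} (hc : IsLimit c)
  [PreservesLimit (K ⋙ forgetComod k C) (tensorRight (ModuleCat.of k C))]

/-- The coaction on a limit of comodules. -/
def limitCoact : c.pt ⟶ c.pt ⊗ ModuleCat.of k C :=
  (isLimitOfPreserves (tensorRight (ModuleCat.of k C)) hc).lift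
    ((Cone.postcompose (Functor.whiskerLeft K (coactNat k C))).obj c)

theorem limitCoact_π (j : J) : limitCoact K hc ≫ c.π.app j ▷ ModuleCat.of k C =
    c.π.app j ≫ (coactNat k C).app (K.obj j) :=
  (isLimitOfPreserves (tensorRight (ModuleCat.of k C)) hc).fac _ j

theorem limitCoact_π_assoc (j : J) {Z : ModuleCat.{u} k}
    (f : (K ⋙ forgetComod k C).obj j ⊗ ModuleCat.of k C ⟶ Z) :
    limitCoact K hc ≫ c.π.app j ▷ ModuleCat.of k C ≫ f =
      c.π.app j ≫ (coactNat k C).app (K.obj j) ≫ f := by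
  rw [← Category.assoc, limitCoact_π, Category.assoc]

variable [PreservesLimit ((K ⋙ forgetComod k C) ⋙ tensorRight (ModuleCat.of k C))
  (tensorRight (ModuleCat.of k C))]

/-- The comodule structure on a limit of comodules. -/
def limitComod : RComod k C :=
  ofArrow c.pt (limitCoact K hc)
    (by
      rw [← cancel_mono (α_ _ _ _).inv]
      -- Coassociativity equates two maps into (pt ⊗ C) ⊗ C, so it is tested on the limit cone
      -- tensored twice with C; this is the role of the second preservation hypothesis.
      refine (isLimitOfPreserves (tensorRight (ModuleCat.of k C))
        (isLimitOfPreserves (tensorRight (ModuleCat.of k C)) hc)).hom_ext fun j => ?_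
      have h := coactNat_coassoc (K.obj j)
      rw [← cancel_mono (α_ _ _ _).inv] at h
      simp only [Category.assoc, Iso.hom_inv_id, Category.comp_id] at h ⊢
      dsimp only [Functor.mapCone_π_app, Functor.flip_obj_map, curriedTensor_map_app]
      change _ ≫ _ ≫ _ ▷ _ ▷ _ = _ ≫ _ ≫ _ ≫ _ ▷ _ ▷ _
      rw [← comp_whiskerRight, limitCoact_π, comp_whiskerRight, limitCoact_π_assoc, h,
        ← associator_inv_naturality_left, whisker_exchange_assoc, limitCoact_π_assoc]
      rfl)
    (by
      refine hc.hom_ext fun j => ?_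
      have h := coactNat_counit (K.obj j)
      rw [Category.assoc, Category.assoc, ← rightUnitor_naturality, whisker_exchange_assoc,
        limitCoact_π_assoc, Category.id_comp]
      exact (congrArg (c.π.app j ≫ ·) h).trans (Category.comp_id _))

/-- The limit cone in the category of comodules. -/
def limitComodCone : Cone K where
  pt := limitComod K hc
  π := {
    app j := homOfCommutes (M := limitComod K hc) (c.π.app j) (limitCoact_π K hc j).symm
    naturality _ _ f := (forgetComod k C).map_injective (c.π.naturality f) }

/-- The cone `limitComodCone` lies over the given limit cone `c`, hence is itself a limit by
reflection; one limit cone sent to a limit cone suffices. -/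
theorem preservesLimit_forgetComod (hc : IsLimit c) : PreservesLimit K (forgetComod k C) :=
  have h : IsLimit ((forgetComod k C).mapCone (limitComodCone K hc)) := hc
  preservesLimit_of_preserves_limit_cone (isLimitOfReflects (forgetComod k C) h) h

end Limits


/-- Over a field - ⊗ C is exact, so the preservation hypotheses hold for finite diagrams. -/
instance : PreservesFiniteLimits (forgetComod k C) where
  preservesFiniteLimits _ _ _ :=
    ⟨fun {K} => preservesLimit_forgetComod K (limit.isLimit (K ⋙ forgetComod k C))⟩

instance : ReflectsFiniteLimits (forgetComod k C) where
  reflects _ _ _ := ⟨inferInstance⟩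

variable (C) in
/-- The cofree comodule `V ⊗ C`. -/
@[reducible]
def cofree (V : Type u) [AddCommGroup V] [Module k V] : RComod k C where
  carrier := V ⊗[k] C
  coact := (TensorProduct.assoc k V C C).symm.toLinearMap ∘ₗ
    (Coalgebra.comul (R := k) (A := C)).lTensor V
  coassoc t := by
    induction t with
    | zero => simp
    | add x y hx hy => simp only [map_add, hx, hy]
    | tmul v c =>
      have h1 : ∀ x : C ⊗[k] C, TensorProduct.assoc k (V ⊗[k] C) C C
          (((TensorProduct.assoc k V C C).symm.toLinearMap ∘ₗ
            (Coalgebra.comul (R := k) (A := C)).lTensor V).rTensor C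
              ((TensorProduct.assoc k V C C).symm (v ⊗ₜ x))) =
          (TensorProduct.assoc k V C (C ⊗[k] C)).symm (v ⊗ₜ TensorProduct.assoc k C C C
            ((Coalgebra.comul (R := k) (A := C)).rTensor C x)) := by
        intro x
        induction x with
        | zero => simp
        | add x y hx hy => simp only [TensorProduct.tmul_add, map_add, hx, hy]
        | tmul a b =>
          simp only [TensorProduct.assoc_symm_tmul, LinearMap.rTensor_tmul,
            LinearMap.comp_apply, LinearMap.lTensor_tmul, LinearEquiv.coe_coe]
          generalize Coalgebra.comul (R := k) a = y
          induction y with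
          | zero => simp
          | add x y hx hy =>
            simp only [TensorProduct.tmul_add, TensorProduct.add_tmul, map_add, hx, hy]
          | tmul a b => simp
      have h2 : ∀ x : C ⊗[k] C, (Coalgebra.comul (R := k) (A := C)).lTensor (V ⊗[k] C)
            ((TensorProduct.assoc k V C C).symm (v ⊗ₜ x)) =
          (TensorProduct.assoc k V C (C ⊗[k] C)).symm (v ⊗ₜ
            ((Coalgebra.comul (R := k) (A := C)).lTensor C x)) := by
        intro x
        induction x with
        | zero => simp
        | add x y hx hy => simp only [TensorProduct.tmul_add, map_add, hx, hy]
        | tmul a b => simp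
      simp only [LinearMap.comp_apply, LinearMap.lTensor_tmul, LinearEquiv.coe_coe] at h1 h2 ⊢
      rw [h1, h2, Coalgebra.coassoc_apply]
  counit_coact t := by
    induction t with
    | zero => simp
    | add x y hx hy => simp only [map_add, hx, hy]
    | tmul v c =>
      have h2 : ∀ x : C ⊗[k] C, TensorProduct.rid k (V ⊗[k] C)
          ((Coalgebra.counit (R := k) (A := C)).lTensor (V ⊗[k] C)
            ((TensorProduct.assoc k V C C).symm (v ⊗ₜ x))) =
          v ⊗ₜ TensorProduct.rid k C ((Coalgebra.counit (R := k) (A := C)).lTensor C x) := by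
        intro x
        induction x with
        | zero => simp
        | add x y hx hy => simp only [TensorProduct.tmul_add, map_add, hx, hy]
        | tmul a b => simp
      simp only [LinearMap.comp_apply, LinearMap.lTensor_tmul, LinearEquiv.coe_coe] at h2 ⊢
      rw [h2, Coalgebra.lTensor_counit_comul]
      simp

/-- The comodule map into a cofree comodule extending a linear map. -/
def toCofree {M : RComod k C} {V : Type u} [AddCommGroup V] [Module k V]
    (f : M.carrier →ₗ[k] V) : M ⟶ cofree C V where
  lin := f.rTensor C ∘ₗ M.coact
  comm m := by
    have h : ∀ x : M.carrier ⊗[k] C, (f.rTensor C ∘ₗ M.coact).rTensor C x =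
        (TensorProduct.assoc k V C C).symm (f.rTensor (C ⊗[k] C)
          (TensorProduct.assoc k M.carrier C C (M.coact.rTensor C x))) := by
      intro x
      rw [LinearEquiv.eq_symm_apply, LinearMap.rTensor_comp, LinearMap.comp_apply]
      generalize (M.coact.rTensor C x) = y
      induction y with
      | zero => simp
      | add x y hx hy => simp only [map_add, hx, hy]
      | tmul a b =>
        induction a with
        | zero => simp
        | add x y hx hy => simp only [TensorProduct.add_tmul, map_add, hx, hy]
        | tmul a c => simp
    refine Eq.trans ?_ (h (M.coact m)).symm
    rw [M.coassoc]
    simp only [LinearMap.comp_apply, LinearEquiv.coe_coe]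
    rw [← LinearMap.comp_apply (LinearMap.lTensor _ _), ← LinearMap.comp_apply (f.rTensor _),
      LinearMap.lTensor_comp_rTensor, LinearMap.rTensor_comp_lTensor]

/-- The projection from a cofree comodule. -/
def cofreeCounit (V : Type u) [AddCommGroup V] [Module k V] : V ⊗[k] C →ₗ[k] V :=
  (TensorProduct.rid k V).toLinearMap ∘ₗ (Coalgebra.counit (R := k) (A := C)).lTensor V

theorem toCofree_counit {M : RComod k C} {V : Type u} [AddCommGroup V] [Module k V]
    (f : M.carrier →ₗ[k] V) : cofreeCounit V ∘ₗ (toCofree f).lin = f := by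
  ext m
  have h : ∀ x : M.carrier ⊗[k] C, cofreeCounit V (f.rTensor C x) = f (cofreeCounit _ x) := by
    intro x
    induction x with
    | zero => simp
    | add x y hx hy => simp only [map_add, hx, hy]
    | tmul a b => simp [cofreeCounit]
  exact (h _).trans (congrArg f (M.counit_coact m))

theorem toCofree_counit_comp {M : RComod k C} {V : Type u} [AddCommGroup V] [Module k V]
    (f : M ⟶ cofree C V) : toCofree (cofreeCounit V ∘ₗ f.lin) = f := by
  ext m
  have h : ∀ x : V ⊗[k] C, (cofreeCounit V).rTensor C ((cofree C V).coact x) = x := by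
    intro x
    induction x with
    | zero => simp
    | add x y hx hy => simp only [map_add, hx, hy]
    | tmul v c =>
      have h2 : ∀ x : C ⊗[k] C, (cofreeCounit V).rTensor C
            ((TensorProduct.assoc k V C C).symm (v ⊗ₜ x)) =
          v ⊗ₜ TensorProduct.lid k C ((Coalgebra.counit (R := k) (A := C)).rTensor C x) := by
        intro x
        induction x with
        | zero => simp
        | add x y hx hy => simp only [TensorProduct.tmul_add, map_add, hx, hy]
        | tmul a b => simp [cofreeCounit, TensorProduct.smul_tmul]
      simp only [LinearMap.comp_apply, LinearMap.lTensor_tmul, LinearEquiv.coe_coe]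
      rw [h2, Coalgebra.rTensor_counit_comul]
      simp
  change (cofreeCounit V ∘ₗ f.lin).rTensor C (M.coact m) = f.lin m
  rw [LinearMap.rTensor_comp, LinearMap.comp_apply, ← f.comm, h]

theorem toCofree_comp {M N : RComod k C} (g : M ⟶ N) {V : Type u} [AddCommGroup V] [Module k V]
    (f : N.carrier →ₗ[k] V) : g ≫ toCofree f = toCofree (f ∘ₗ g.lin) := by
  ext m
  change f.rTensor C (N.coact (g.lin m)) = (f ∘ₗ g.lin).rTensor C (M.coact m)
  rw [g.comm, LinearMap.rTensor_comp, LinearMap.comp_apply]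

/-- The universal property of cofree comodules. -/
def cofreeHomEquiv (M : RComod k C) (V : ModuleCat.{u} k) :
    ((forgetComod k C).obj M ⟶ V) ≃ (M ⟶ cofree C V) where
  toFun f := toCofree f.hom
  invFun g := ModuleCat.ofHom (cofreeCounit V ∘ₗ g.lin)
  left_inv f := ModuleCat.hom_ext (toCofree_counit f.hom)
  right_inv g := toCofree_counit_comp g

/-- The right adjoint is V ↦ V ⊗ C. Consequently the forgetful functor preserves colimits. -/
instance : (forgetComod k C).IsLeftAdjoint :=
  (Adjunction.adjunctionOfEquivRight cofreeHomEquiv fun _ _ _ f g =>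
    (toCofree_comp f g.hom).symm).isLeftAdjoint

/-- A functor between categories of comodules that is exact and cocontinuous on underlying vector
spaces preserves finite limits. -/
theorem preservesFiniteLimits_of_forget {D : Type u} [AddCommGroup D] [Module k D] [Coalgebra k D]
    (F : RComod k C ⥤ RComod k D) (T : ModuleCat.{u} k ⥤ ModuleCat.{u} k)
    (e : F ⋙ forgetComod k D ≅ forgetComod k C ⋙ T) [PreservesFiniteLimits T] :
    PreservesFiniteLimits F :=
  have : PreservesFiniteLimits (F ⋙ forgetComod k D) := preservesFiniteLimits_of_natIso e.symm
  preservesFiniteLimits_of_reflects_of_preserves F (forgetComod k D)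

theorem preservesColimitsOfShape_of_forget {D : Type u} [AddCommGroup D] [Module k D]
    [Coalgebra k D] {J : Type u} [Category.{u} J]
    (F : RComod k C ⥤ RComod k D) (T : ModuleCat.{u} k ⥤ ModuleCat.{u} k)
    (e : F ⋙ forgetComod k D ≅ forgetComod k C ⋙ T) [PreservesColimitsOfShape J T] :
    PreservesColimitsOfShape J F :=
  have : PreservesColimitsOfShape J (F ⋙ forgetComod k D) :=
    preservesColimitsOfShape_of_natIso e.symm
  have : ReflectsColimitsOfShape J (forgetComod k D) := ⟨inferInstance⟩
  preservesColimitsOfShape_of_reflects_of_preserves F (forgetComod k D)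

end Forget
end RComod

/-! ### Invertibility of a natural transformation at limits and colimits -/

section Generalities

variable {A B J : Type*} [Category* A] [Category* B] [Category* J]

/-- The component at the cone point is the map induced between two limits by an isomorphism of
diagrams. -/
theorem isIso_app_conePt_of_preservesLimit (K : J ⥤ A) {L L' : A ⥤ B} (α : L ⟶ L')
    (h : ∀ j, IsIso (α.app (K.obj j))) (c : Cone K) (hc : IsLimit c)
    [PreservesLimit K L] [PreservesLimit K L'] : IsIso (α.app c.pt) := by
  have : ∀ j, IsIso ((Functor.whiskerLeft K α).app j) := h
  have : IsIso (Functor.whiskerLeft K α) := NatIso.isIso_of_isIso_app _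
  let e := IsLimit.conePointsIsoOfNatIso
    (isLimitOfPreserves L hc) (isLimitOfPreserves L' hc) (asIso (Functor.whiskerLeft K α))
  have he : e.hom = α.app c.pt := (isLimitOfPreserves L' hc).hom_ext fun j => by
    refine (IsLimit.map_π _ _ _ j).trans ?_
    exact α.naturality (c.π.app j)
  rw [← he]
  infer_instance

theorem isIso_app_coconePt_of_preservesColimit (K : J ⥤ A) {L L' : A ⥤ B} (α : L ⟶ L')
    (h : ∀ j, IsIso (α.app (K.obj j))) (c : Cocone K) (hc : IsColimit c)
    [PreservesColimit K L] [PreservesColimit K L'] : IsIso (α.app c.pt) := by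
  have : ∀ j, IsIso ((Functor.whiskerLeft K α).app j) := h
  have : IsIso (Functor.whiskerLeft K α) := NatIso.isIso_of_isIso_app _
  exact Limits.isIso_app_coconePt_of_preservesColimit K α c hc

end Generalities

namespace RComod

/-! ### Reduction of arbitrary comodules to the coalgebra itself -/

section Cofree

variable {k : Type u} [Field k] {C : Type u} [AddCommGroup C] [Module k C] [Coalgebra k C]

variable (k C) in
/-- The coalgebra `C` as a comodule over itself. -/
@[reducible]
def regular : RComod k C where
  carrier := C
  coact := Coalgebra.comul
  coassoc := Coalgebra.coassoc_apply
  counit_coact c := by simp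

variable {V W : Type u} [AddCommGroup V] [Module k V] [AddCommGroup W] [Module k W]

theorem cofree_coact_tmul (v : V) (c : C) : (cofree (k := k) C V).coact (v ⊗ₜ c) =
    (TensorProduct.assoc k V C C).symm (v ⊗ₜ Coalgebra.comul c) := rfl

/-- The inclusion of `C` into `V ⊗ C` attached to a vector of `V`. -/
def cofreeInj (v : V) : regular k C ⟶ cofree C V where
  lin := TensorProduct.mk k V C v
  comm c := by
    change (TensorProduct.assoc k V C C).symm (v ⊗ₜ Coalgebra.comul c) =
      (TensorProduct.mk k V C v).rTensor C (Coalgebra.comul c)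
    generalize Coalgebra.comul (R := k) c = x
    induction x with
    | zero => simp
    | add x y hx hy => simp only [TensorProduct.tmul_add, map_add, hx, hy]
    | tmul a b => simp

/-- The cofree comodule `V ⊗ C` is a coproduct of copies of `C`. -/
def cofreeIsColimit {ι : Type u} (b : Module.Basis ι k V) :
    IsColimit (Cofan.mk (f := fun _ : ι => regular k C) (cofree C V) fun i => cofreeInj (b i)) :=
  Cofan.IsColimit.mk _
    (fun s =>
      let φ : ∀ i, C →ₗ[k] s.pt.carrier := fun i => Hom.lin (s.inj i)
      { lin := TensorProduct.lift (b.constr k φ)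
        comm := by
          have h : ∀ i c, s.pt.coact (φ i c) = (φ i).rTensor C (Coalgebra.comul c) :=
            fun i => (s.inj i).comm
          suffices s.pt.coact ∘ₗ TensorProduct.lift (b.constr k φ) =
              (TensorProduct.lift (b.constr k φ)).rTensor C ∘ₗ (cofree (k := k) C V).coact from
            LinearMap.congr_fun this
          refine TensorProduct.ext (b.ext fun i => LinearMap.ext fun c => ?_)
          have h' := (cofreeInj (k := k) (C := C) (b i)).comm c
          change s.pt.coact (b.constr k φ (b i) c) =
            (TensorProduct.lift (b.constr k φ)).rTensor C ((cofree (k := k) C V).coact (b i ⊗ₜ c))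
          change (cofree (k := k) C V).coact (b i ⊗ₜ c) =
            (TensorProduct.mk k V C (b i)).rTensor C _ at h'
          rw [h', ← LinearMap.rTensor_comp_apply, b.constr_basis, h]
          congr 2
          ext c
          simp })
    (fun s i => by
      ext c
      change b.constr k (fun i => Hom.lin (s.inj i)) (b i) c = _
      rw [b.constr_basis])
    (fun s m hm => by
      apply hom_ext
      refine TensorProduct.ext (b.ext fun i => ?_)
      have := congrArg Hom.lin (hm i)
      ext c
      change m.lin (b i ⊗ₜ c) = b.constr k (fun i => Hom.lin (s.inj i)) (b i) c
      rw [b.constr_basis, ← this]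
      rfl)

/-- Functoriality of cofree comodules. -/
def cofreeMap (f : V →ₗ[k] W) : cofree (k := k) C V ⟶ cofree C W where
  lin := f.rTensor C
  comm t := by
    have h : ∀ t : V ⊗[k] C, (cofree (k := k) C W).coact (f.rTensor C t) =
        (f.rTensor C).rTensor C ((cofree (k := k) C V).coact t) := by
      intro t
      induction t with
      | zero => simp
      | add x y hx hy => simp only [map_add, hx, hy]
      | tmul v c =>
        rw [LinearMap.rTensor_tmul, cofree_coact_tmul, cofree_coact_tmul]
        generalize Coalgebra.comul (R := k) c = x
        induction x with
        | zero => simp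
        | add x y hx hy => simp only [TensorProduct.tmul_add, map_add, hx, hy]
        | tmul a b => simp
    exact h t

/-- The coaction as a morphism into a cofree comodule. -/
def coactHom (M : RComod k C) : M ⟶ cofree C M.carrier where
  lin := M.coact
  comm m := by
    rw [LinearMap.comp_apply, ← M.coassoc]
    simp

theorem cofreeCounit_rTensor (f : V →ₗ[k] W) (t : V ⊗[k] C) :
    cofreeCounit W (f.rTensor C t) = f (cofreeCounit V t) := by
  induction t with
  | zero => simp
  | add x y hx hy => simp only [map_add, hx, hy]
  | tmul a b => simp [cofreeCounit]

theorem cofreeCounit_coact (M : RComod k C) (m : M.carrier) :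
    cofreeCounit M.carrier (M.coact m) = m := M.counit_coact m

/-- Every comodule is an equalizer of cofree comodules. -/
def coactFork (M : RComod k C) :
    Fork (cofreeMap M.coact) (coactHom (cofree C M.carrier)) :=
  Fork.ofι (coactHom M) (by
    ext m
    change M.coact.rTensor C (M.coact m) = (cofree C M.carrier).coact (M.coact m)
    rw [LinearMap.comp_apply, ← M.coassoc]
    simp)

/-- The inverse of the coaction ρ onto the equalizer is id ⊗ ε. If (ρ ⊗ id)t = (id ⊗ Δ)t, then
applying ε to the last factor gives ρ((id ⊗ ε)t) = t, which is `key`. -/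
def coactForkIsLimit (M : RComod k C) : IsLimit (coactFork M) :=
  have key (s : Fork (cofreeMap M.coact) (coactHom (cofree C M.carrier))) (x : s.pt.carrier) :
      M.coact (cofreeCounit M.carrier (Hom.lin s.ι x)) = Hom.lin s.ι x := by
    rw [← cofreeCounit_rTensor]
    have h : M.coact.rTensor C (Hom.lin s.ι x) = (cofree C M.carrier).coact (Hom.lin s.ι x) :=
      LinearMap.congr_fun (congrArg Hom.lin s.condition) x
    rw [h]
    exact cofreeCounit_coact (cofree C M.carrier) _
  Fork.IsLimit.mk _
    (fun s =>
      let φ : s.pt.carrier →ₗ[k] M.carrier ⊗[k] C := Hom.lin s.ι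
      let ψ : s.pt.carrier →ₗ[k] M.carrier := cofreeCounit M.carrier ∘ₗ φ
      { lin := ψ
        comm := fun x => by
          -- Colinearity of ψ: ρ ∘ ψ is the leg `s.ι` by `key`, and `s.ι`, being colinear into a
          -- cofree comodule, is determined by its composite ψ with the counit.
          refine (key s x).trans ?_
          exact (LinearMap.congr_fun (congrArg Hom.lin (toCofree_counit_comp s.ι)) x).symm })
    (fun s => by
      ext x
      exact key s x)
    (fun s m hm => by
      ext x
      have h : M.coact (Hom.lin m x) = Hom.lin s.ι x :=
        LinearMap.congr_fun (congrArg Hom.lin hm) x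
      change _ = cofreeCounit M.carrier (Hom.lin s.ι x)
      rw [← h]
      exact (cofreeCounit_coact M _).symm)

/-- A natural transformation between left exact coproduct preserving functors on comodules is
invertible as soon as its component at the coalgebra is. -/
theorem isIso_app_of_isIso_app_regular {B : Type*} [Category* B] {F G : RComod k C ⥤ B}
    (τ : F ⟶ G) [PreservesFiniteLimits F] [PreservesFiniteLimits G]
    [∀ J : Type u, PreservesColimitsOfShape (Discrete J) F]
    [∀ J : Type u, PreservesColimitsOfShape (Discrete J) G]
    [h : IsIso (τ.app (regular k C))] (M : RComod k C) : IsIso (τ.app M) := by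
  have h1 (V : Type u) [AddCommGroup V] [Module k V] : IsIso (τ.app (cofree C V)) :=
    isIso_app_coconePt_of_preservesColimit _ τ (fun _ => h) _
      (cofreeIsColimit (Module.Basis.ofVectorSpace k V))
  -- Both objects of the fork are cofree, on M and on M ⊗ C.
  exact isIso_app_conePt_of_preservesLimit _ τ (by rintro (_ | _) <;> exact h1 _) _
    (coactForkIsLimit M)

end Cofree

/-! ### Exactness of the action in each variable -/

section Action

variable {k : Type u} [Field k] {H : Type u} [Ring H] [Bialgebra k H]
  {C : Type u} [AddCommGroup C] [Module k C] [Module H C] [IsScalarTower k H C] [Coalgebra k C]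
  [IsModuleCoalgebra k H C]

variable (C) in
/-- The functor `X ⊗ -`. -/
@[simps]
def actLeft (X : RComod k H) : RComod k C ⥤ RComod k C where
  obj M := X ⊙ₗ M
  map g := X ⊴ₗ g

variable (H) in
/-- The functor `- ⊗ M`. -/
@[simps]
def actRight (M : RComod k C) : RComod k H ⥤ RComod k C where
  obj X := X ⊙ₗ M
  map f := f ⊵ₗ M

def actLeftForget (X : RComod k H) : actLeft C X ⋙ forgetComod k C ≅
    forgetComod k C ⋙ tensorLeft (ModuleCat.of k X.carrier) :=
  NatIso.ofComponents (fun M => Iso.refl (ModuleCat.of k (X.carrier ⊗[k] M.carrier)))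
    (fun _ => rfl)

def actRightForget (M : RComod k C) : actRight H M ⋙ forgetComod k C ≅
    forgetComod k H ⋙ tensorRight (ModuleCat.of k M.carrier) :=
  NatIso.ofComponents (fun X => Iso.refl (ModuleCat.of k (X.carrier ⊗[k] M.carrier)))
    (fun _ => rfl)

instance (V : ModuleCat.{u} k) {J : Type*} [Category* J] :
    PreservesColimitsOfShape J (tensorRight V) :=
  preservesColimitsOfShape_of_natIso (BraidedCategory.tensorLeftIsoTensorRight V)

instance (X : RComod k H) : PreservesFiniteLimits (actLeft C X) :=
  preservesFiniteLimits_of_forget _ _ (actLeftForget X)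

instance (M : RComod k C) : PreservesFiniteLimits (actRight H M) :=
  preservesFiniteLimits_of_forget _ _ (actRightForget M)

instance (X : RComod k H) (J : Type u) : PreservesColimitsOfShape (Discrete J) (actLeft C X) :=
  preservesColimitsOfShape_of_forget _ _ (actLeftForget X)

instance (M : RComod k C) (J : Type u) : PreservesColimitsOfShape (Discrete J) (actRight H M) :=
  preservesColimitsOfShape_of_forget _ _ (actRightForget M)

end Action

end RComod

/-! ### Inverting h ⊗ n ↦ h₍₁₎ ⊗ h₍₂₎n with an antipode -/

section Convolution

variable {k : Type u} [Field k] {H : Type u} [Ring H] {N : Type u} [AddCommGroup N] [Module k N]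

/-- The map `h ⊗ n ↦ h₍₁₎ ⊗ f (h₍₂₎ ⊗ n)`. -/
def comulExtend [Bialgebra k H] (f : H ⊗[k] N →ₗ[k] N) : H ⊗[k] N →ₗ[k] H ⊗[k] N :=
  f.lTensor H ∘ₗ (TensorProduct.assoc k H H N).toLinearMap ∘ₗ
    (Coalgebra.comul (R := k) (A := H)).rTensor N

/-- `comulExtend f` is the left colinear endomorphism of H ⊗ N with component f, and composites of
colinear maps are colinear. In elements this is coassociativity. It reduces identities between such
endomorphisms to identities between their components. -/
theorem comulExtend_comp [Bialgebra k H] (f g : H ⊗[k] N →ₗ[k] N) :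
    comulExtend f ∘ₗ comulExtend g = comulExtend (f ∘ₗ comulExtend g) := by
  refine TensorProduct.ext' fun h n => ?_
  have h1 : ∀ x : H ⊗[k] H, comulExtend f (g.lTensor H (TensorProduct.assoc k H H N (x ⊗ₜ n))) =
      (f ∘ₗ g.lTensor H).lTensor H ((TensorProduct.assoc k H H N).toLinearMap.lTensor H
        (TensorProduct.assoc k H (H ⊗[k] H) N (TensorProduct.assoc k H H H
          ((Coalgebra.comul (R := k) (A := H)).rTensor H x) ⊗ₜ n))) := by
    intro x
    induction x with
    | zero => simp
    | add x y hx hy => simp only [TensorProduct.add_tmul, map_add, hx, hy]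
    | tmul a b =>
      simp only [comulExtend, TensorProduct.assoc_tmul, LinearMap.lTensor_tmul,
        LinearMap.comp_apply, LinearMap.rTensor_tmul]
      generalize Coalgebra.comul (R := k) a = y
      induction y with
      | zero => simp
      | add x y hx hy => simp only [TensorProduct.add_tmul, map_add, hx, hy]
      | tmul a c => simp
  have h2 : ∀ x : H ⊗[k] H, (f ∘ₗ comulExtend g).lTensor H
        (TensorProduct.assoc k H H N (x ⊗ₜ n)) =
      (f ∘ₗ g.lTensor H).lTensor H ((TensorProduct.assoc k H H N).toLinearMap.lTensor H
        (TensorProduct.assoc k H (H ⊗[k] H) N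
          ((Coalgebra.comul (R := k) (A := H)).lTensor H x ⊗ₜ n))) := by
    intro x
    induction x with
    | zero => simp
    | add x y hx hy => simp only [TensorProduct.add_tmul, map_add, hx, hy]
    | tmul a b => simp [comulExtend]
  refine (h1 (Coalgebra.comul h)).trans ?_
  rw [Coalgebra.coassoc_apply, ← h2]
  rfl

theorem comulExtend_counit [Bialgebra k H] :
    comulExtend ((TensorProduct.lid k N).toLinearMap ∘ₗ
      (Coalgebra.counit (R := k) (A := H)).rTensor N) = LinearMap.id := by
  refine TensorProduct.ext' fun h n => ?_
  have h1 : ∀ x : H ⊗[k] H, ((TensorProduct.lid k N).toLinearMap ∘ₗ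
      (Coalgebra.counit (R := k) (A := H)).rTensor N).lTensor H
        (TensorProduct.assoc k H H N (x ⊗ₜ n)) =
      TensorProduct.rid k H ((Coalgebra.counit (R := k) (A := H)).lTensor H x) ⊗ₜ n := by
    intro x
    induction x with
    | zero => simp
    | add x y hx hy => simp only [TensorProduct.add_tmul, map_add, hx, hy]
    | tmul a b => simp [TensorProduct.smul_tmul]
  refine (h1 (Coalgebra.comul h)).trans ?_
  simp

variable [HopfAlgebra k H] (a : H ⊗[k] N →ₗ[k] N) (h_one : ∀ n, a (1 ⊗ₜ n) = n)
  (h_mul : ∀ (g h : H) (n : N), a ((g * h) ⊗ₜ n) = a (g ⊗ₜ a (h ⊗ₜ n)))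

include h_one in
theorem act_algebraMap (c : k) (n : N) : a (algebraMap k H c ⊗ₜ n) = c • n := by
  rw [Algebra.algebraMap_eq_smul_one, ← TensorProduct.smul_tmul', map_smul, h_one]

include h_one h_mul

/-- On components, the claim is h₍₁₎S(h₍₂₎)n = ε(h)n, the antipode axiom acting on a module. The
opposite composite below uses the other antipode axiom. -/
theorem comulExtend_comp_antipode :
    comulExtend a ∘ₗ comulExtend (a ∘ₗ (HopfAlgebra.antipode k (A := H)).rTensor N) =
      LinearMap.id := by
  rw [comulExtend_comp, ← comulExtend_counit]
  congr 1
  refine TensorProduct.ext' fun h n => ?_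
  have h1 : ∀ x : H ⊗[k] H, a ((a ∘ₗ (HopfAlgebra.antipode k (A := H)).rTensor N).lTensor H
      (TensorProduct.assoc k H H N (x ⊗ₜ n))) =
      a (LinearMap.mul' k H ((HopfAlgebra.antipode k (A := H)).lTensor H x) ⊗ₜ n) := by
    intro x
    induction x with
    | zero => simp
    | add x y hx hy => simp only [TensorProduct.add_tmul, map_add, hx, hy]
    | tmul b c => simp [h_mul]
  refine (h1 (Coalgebra.comul h)).trans ?_
  rw [HopfAlgebra.mul_antipode_lTensor_comul_apply, act_algebraMap a h_one]
  simp

theorem antipode_comp_comulExtend :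
    comulExtend (a ∘ₗ (HopfAlgebra.antipode k (A := H)).rTensor N) ∘ₗ comulExtend a =
      LinearMap.id := by
  rw [comulExtend_comp, ← comulExtend_counit]
  congr 1
  refine TensorProduct.ext' fun h n => ?_
  have h1 : ∀ x : H ⊗[k] H, (a ∘ₗ (HopfAlgebra.antipode k (A := H)).rTensor N)
      (a.lTensor H (TensorProduct.assoc k H H N (x ⊗ₜ n))) =
      a (LinearMap.mul' k H ((HopfAlgebra.antipode k (A := H)).rTensor H x) ⊗ₜ n) := by
    intro x
    induction x with
    | zero => simp
    | add x y hx hy => simp only [TensorProduct.add_tmul, map_add, hx, hy]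
    | tmul b c => simp [h_mul]
  refine (h1 (Coalgebra.comul h)).trans ?_
  rw [HopfAlgebra.mul_antipode_rTensor_comul_apply, act_algebraMap a h_one]
  simp

/-- For a module over a Hopf algebra, `h ⊗ n ↦ h₍₁₎ ⊗ h₍₂₎ n` is invertible. -/
def comulExtendEquiv : H ⊗[k] N ≃ₗ[k] H ⊗[k] N :=
  LinearEquiv.ofLinearMap (comulExtend a)
    (comulExtend (a ∘ₗ (HopfAlgebra.antipode k (A := H)).rTensor N))
    (comulExtend_comp_antipode a h_one h_mul) (antipode_comp_comulExtend a h_one h_mul)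

end Convolution

namespace RComod

/-! ### Trivial comodules, and module coalgebras as modules inside comodules -/

section Trivial

variable {k : Type u} [Field k] {H : Type u} [Ring H] [Bialgebra k H]

variable (H) in
/-- A vector space with the trivial coaction. -/
@[reducible]
def triv (V : Type u) [AddCommGroup V] [Module k V] : RComod k H where
  carrier := V
  coact := (TensorProduct.mk k V H).flip 1
  coassoc v := by simp [Algebra.TensorProduct.one_def]
  counit_coact v := by simp

variable {V : Type u} [AddCommGroup V] [Module k V]

/-- Morphisms out of the unit pick out coinvariant vectors, which is why a trivial comodule is a
coproduct of units. -/
theorem unit_hom_coact {M : RComod k H} (f : unit k H ⟶ M) :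
    M.coact (f.lin (1 : k)) = f.lin (1 : k) ⊗ₜ 1 := f.comm (1 : k)

/-- The morphism from the unit attached to a vector of a trivial comodule. -/
def trivInj (v : V) : unit k H ⟶ triv (k := k) H V where
  lin := LinearMap.toSpanSingleton k V v
  comm r := by
    change (r • v) ⊗ₜ[k] (1 : H) = (LinearMap.toSpanSingleton k V v).rTensor H (r ⊗ₜ 1)
    simp

/-- A trivial comodule is a coproduct of copies of the unit. -/
def trivIsColimit {ι : Type u} (b : Module.Basis ι k V) :
    IsColimit (Cofan.mk (f := fun _ : ι => unit k H) (triv (k := k) H V)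
      fun i => trivInj (b i)) :=
  Cofan.IsColimit.mk _
    (fun s =>
      let φ : ι → s.pt.carrier := fun i => Hom.lin (s.inj i) (1 : k)
      { lin := b.constr k φ
        comm := by
          have h : ∀ i, s.pt.coact (φ i) = φ i ⊗ₜ 1 := fun i => unit_hom_coact (s.inj i)
          suffices s.pt.coact ∘ₗ b.constr k φ =
              (b.constr k φ).rTensor H ∘ₗ (TensorProduct.mk k V H).flip 1 from
            LinearMap.congr_fun this
          refine b.ext fun i => ?_
          simp [h] })
    (fun s i => by
      apply hom_ext
      refine LinearMap.ext_ring ?_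
      change b.constr k (fun i => Hom.lin (s.inj i) (1 : k)) ((1 : k) • b i) = _
      rw [one_smul, b.constr_basis])
    (fun s m hm => by
      apply hom_ext
      refine b.ext fun i => ?_
      change m.lin (b i) = b.constr k (fun i => Hom.lin (s.inj i) (1 : k)) (b i)
      rw [b.constr_basis, ← hm i]
      change m.lin (b i) = m.lin ((1 : k) • b i)
      rw [one_smul])

variable (k H) in
/-- Comultiplication as a morphism of comodules. -/
def comulHom : regular k H ⟶ triv (k := k) H H ⊗ regular k H where
  lin := Coalgebra.comul
  comm h := by
    -- The trivial first factor contributes only the element 1 to the coaction, so the coaction on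
    -- the target is id ⊗ Δ and colinearity of Δ becomes coassociativity.
    have h0 : ∀ (a : H) (y : H ⊗[k] H), (actMap k H H).lTensor (H ⊗[k] H)
        (TensorProduct.tensorTensorTensorComm k H H H H ((a ⊗ₜ 1) ⊗ₜ y)) =
          (TensorProduct.assoc k H H H).symm (a ⊗ₜ y) := by
      intro a y
      induction y with
      | zero => simp only [TensorProduct.tmul_zero, map_zero]
      | add x y hx hy => simp only [TensorProduct.tmul_add, map_add, hx, hy]
      | tmul b c => simp
    have h1 : ∀ x : H ⊗[k] H, tensCoact (triv (k := k) H H) (regular k H) x =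
        (TensorProduct.assoc k H H H).symm
          ((Coalgebra.comul (R := k) (A := H)).lTensor H x) := by
      intro x
      induction x with
      | zero => simp
      | add x y hx hy => simp only [map_add, hx, hy]
      | tmul a b => exact h0 a (Coalgebra.comul b)
    refine (h1 (Coalgebra.comul h)).trans ?_
    rw [← Coalgebra.coassoc_apply]
    simp

variable (k H) in
/-- The unit of `H` as a morphism of comodules. -/
def unitHom : unit k H ⟶ regular k H where
  lin := Algebra.linearMap k H
  comm r := by
    change Coalgebra.comul (R := k) (algebraMap k H r) =
      (Algebra.linearMap k H).rTensor H (r ⊗ₜ 1)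
    rw [Bialgebra.comul_algebraMap]
    rfl

variable (k H) (C : Type u) [AddCommGroup C] [Module k C] [Module H C] [IsScalarTower k H C]
  [Coalgebra k C] [IsModuleCoalgebra k H C]

/-- The action of `H` on a module coalgebra as a morphism of comodules. -/
def actHom : regular k H ⊙ₗ regular k C ⟶ regular k C where
  lin := actMap k H C
  comm := by
    suffices Coalgebra.comul ∘ₗ actMap k H C =
        (actMap k H C).rTensor C ∘ₗ tensCoact (regular k H) (regular k C) from
      LinearMap.congr_fun this
    refine TensorProduct.ext' fun h c => ?_
    simp only [LinearMap.comp_apply, actMap_tmul]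
    rw [IsModuleCoalgebra.comul_smul, tensCoact_tmul]
    rw [← LinearMap.comp_apply (LinearMap.rTensor _ _), LinearMap.rTensor_comp_lTensor]
    rfl

/-- Multiplication as a morphism of comodules. -/
def mulHom : regular k H ⊗ regular k H ⟶ regular k H where
  lin := actMap k H H
  comm := (actHom k H H).comm

/-- Together with `actHom_unit`, this says that C is a module over the algebra H inside comodules.
Stated as diagrams, the module axioms can be carried along a lax module functor. -/
theorem actHom_assoc : regular k H ⊴ₗ actHom k H C ≫ actHom k H C =
    (αₗ _ _ _).inv ≫ mulHom k H ⊵ₗ regular k C ≫ actHom k H C := by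
  rw [← cancel_epi (αₗ _ _ _).hom, Iso.hom_inv_id_assoc]
  apply hom_ext
  refine TensorProduct.ext_threefold fun g h c => ?_
  exact (mul_smul g h c).symm

theorem actHom_unit : unitHom k H ⊵ₗ regular k C ≫ actHom k H C = (λₗ _).hom := by
  apply hom_ext
  refine TensorProduct.ext' fun r c => ?_
  change algebraMap k H r • c = r • c
  rw [algebraMap_smul]

end Trivial

section Extend

variable {k : Type u} [Field k] {H : Type u} [Ring H]
  {C : Type u} [AddCommGroup C] [Module k C] [Module H C]

/-- The map `h ⊗ n ↦ h₍₁₎ ⊗ h₍₂₎ n` as a morphism of comodules. -/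
def extendHom [Bialgebra k H] [IsScalarTower k H C] [Coalgebra k C] [IsModuleCoalgebra k H C]
    {N : RComod k C} (a : regular k H ⊙ₗ N ⟶ N) :
    regular k H ⊙ₗ N ⟶ triv (k := k) H H ⊙ₗ N :=
  comulHom k H ⊵ₗ N ≫ (αₗ _ _ _).hom ≫ triv (k := k) H H ⊴ₗ a

/-- The two diagrams evaluate to the axioms of an ordinary H-action on the vector space N, to which
`comulExtendEquiv` applies; a colinear linear isomorphism is an isomorphism of comodules. -/
theorem isIso_extendHom [HopfAlgebra k H] [IsScalarTower k H C] [Coalgebra k C]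
    [IsModuleCoalgebra k H C] {N : RComod k C} (a : regular k H ⊙ₗ N ⟶ N)
    (h_mul : regular k H ⊴ₗ a ≫ a = (αₗ _ _ _).inv ≫ mulHom k H ⊵ₗ N ≫ a)
    (h_one : unitHom k H ⊵ₗ N ≫ a = (λₗ _).hom) : IsIso (extendHom a) := by
  let a' : H ⊗[k] N.carrier →ₗ[k] N.carrier := a.lin
  have h1 : ∀ n, a' (1 ⊗ₜ n) = n := fun n => by
    have := LinearMap.congr_fun (congrArg Hom.lin h_one) ((1 : k) ⊗ₜ n)
    change a' (algebraMap k H 1 ⊗ₜ n) = (1 : k) • n at this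
    rwa [map_one, one_smul] at this
  have h2 : ∀ (g h : H) (n : N.carrier), a' ((g * h) ⊗ₜ n) = a' (g ⊗ₜ a' (h ⊗ₜ n)) :=
    fun g h n => (LinearMap.congr_fun (congrArg Hom.lin h_mul) (g ⊗ₜ (h ⊗ₜ n))).symm
  have : extendHom a = (mkIso (comulExtendEquiv a' h1 h2) (extendHom a).comm).hom := rfl
  rw [this]
  infer_instance

end Extend

end RComod

open RComod

/-! ### Over a Hopf algebra every lax module functor of type ℒ is strong -/

namespace LaxModFunctor

section Bialgebra

variable {k : Type u} [Field k] {H : Type u} [Ring H] [Bialgebra k H] {C D : ModCoalg k H}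
  (F : LaxModFunctor C D)

instance : PreservesFiniteLimits F.functor := F.isTypeL.preservesFiniteLimits

instance (J : Type u) : PreservesColimitsOfShape (Discrete J) F.functor :=
  F.isTypeL.preservesCoproducts J

/-- The structure morphism as a natural transformation in the first variable. -/
@[simps]
def ξLeft (M : RComod k C.carrier) :
    actRight H (F.functor.obj M) ⟶ actRight H M ⋙ F.functor where
  app X := F.ξ X M
  naturality _ _ f := Functor.LaxLeftLinear.μₗ_naturality_left F.functor f M

/-- The structure morphism as a natural transformation in the second variable. -/
@[simps]
def ξRight (X : RComod k H) :
    F.functor ⋙ actLeft D.carrier X ⟶ actLeft C.carrier X ⋙ F.functor where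
  app M := F.ξ X M
  naturality _ _ f := Functor.LaxLeftLinear.μₗ_naturality_right F.functor X f

instance (M : RComod k C.carrier) : PreservesFiniteLimits (actRight H M ⋙ F.functor) :=
  comp_preservesFiniteLimits _ _

instance (X : RComod k H) : PreservesFiniteLimits (F.functor ⋙ actLeft D.carrier X) :=
  comp_preservesFiniteLimits _ _

instance (X : RComod k H) : PreservesFiniteLimits (actLeft C.carrier X ⋙ F.functor) :=
  comp_preservesFiniteLimits _ _

/-- The reduction to the regular comodule is applied twice: in the second variable with X = H fixed,
then in the first variable with M fixed. -/
theorem isIso_ξ_of_regular (h : IsIso (F.ξ (regular k H) (regular k C.carrier)))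
    (X : RComod k H) (M : RComod k C.carrier) : IsIso (F.ξ X M) := by
  have h1 : IsIso ((F.ξRight (regular k H)).app (regular k C.carrier)) := h
  have h2 : IsIso ((F.ξLeft M).app (regular k H)) :=
    isIso_app_of_isIso_app_regular (F.ξRight (regular k H)) M
  exact isIso_app_of_isIso_app_regular (F.ξLeft M) X

/-- The unit axiom makes ξ, followed by the image under F of a unit isomorphism, equal to a unit
isomorphism. -/
theorem isIso_ξ_unit (M : RComod k C.carrier) : IsIso (F.ξ (unit k H) M) := by
  have h := Functor.LaxLeftLinear.μₗ_unitality (C := RComod k H) F.functor M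
  have : IsIso (F.ξ (unit k H) M ≫ F.functor.map (λₗ[RComod k H] M).hom) := by
    have h' : F.ξ (unit k H) M ≫ F.functor.map (λₗ[RComod k H] M).hom =
      (λₗ[RComod k H] (F.functor.obj M)).hom := h.symm
    rw [h']
    infer_instance
  exact IsIso.of_isIso_comp_right _ (F.functor.map (λₗ[RComod k H] M).hom)

theorem isIso_ξ_triv (V : Type u) [AddCommGroup V] [Module k V] (M : RComod k C.carrier) :
    IsIso (F.ξ (triv (k := k) H V) M) :=
  isIso_app_coconePt_of_preservesColimit
    (Discrete.functor fun _ : Module.Basis.ofVectorSpaceIndex k V => unit k H) (F.ξLeft M)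
    (fun _ => F.isIso_ξ_unit M) _
    (trivIsColimit (Module.Basis.ofVectorSpace k V))

/-- The action of `H` on the image of the coalgebra. -/
def regularAct : regular k H ⊙ₗ F.functor.obj (regular k C.carrier) ⟶
    F.functor.obj (regular k C.carrier) :=
  F.ξ _ _ ≫ F.functor.map (actHom k H C.carrier)

/-- Lax module functors carry module objects to module objects: naturality and associativity of ξ
reduce the claim to the image under F of `actHom_assoc`. -/
theorem regularAct_assoc : regular k H ⊴ₗ F.regularAct ≫ F.regularAct =
    (αₗ _ _ _).inv ≫ mulHom k H ⊵ₗ F.functor.obj (regular k C.carrier) ≫ F.regularAct := by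
  simp only [regularAct, MonoidalLeftAction.actionHomRight_comp, Category.assoc]
  rw [Functor.LaxLeftLinear.μₗ_naturality_right_assoc,
    Functor.LaxLeftLinear.μₗ_naturality_left_assoc,
    ← Functor.LaxLeftLinear.μₗ_associativity_inv_assoc,
    ← Functor.map_comp, ← Functor.map_comp, ← Functor.map_comp, actHom_assoc]

theorem regularAct_unit :
    unitHom k H ⊵ₗ F.functor.obj (regular k C.carrier) ≫ F.regularAct = (λₗ _).hom := by
  simp only [regularAct]
  rw [Functor.LaxLeftLinear.μₗ_naturality_left_assoc, ← Functor.map_comp, actHom_unit]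
  exact (Functor.LaxLeftLinear.μₗ_unitality F.functor _).symm

/-- The comparison square. Naturality of ξ along Δ in the first variable, associativity of ξ for the
pair H_triv, H, and naturality along the action in the second variable account for the three factors
of `extendHom`. -/
theorem ξ_extendHom :
    F.ξ (regular k H) (regular k C.carrier) ≫ F.functor.map (extendHom (actHom k H C.carrier)) =
      extendHom F.regularAct ≫ F.ξ (triv (k := k) H H) (regular k C.carrier) := by
  simp only [extendHom, regularAct, MonoidalLeftAction.actionHomRight_comp, Category.assoc,
    Functor.map_comp]
  rw [Functor.LaxLeftLinear.μₗ_naturality_right, ← Functor.LaxLeftLinear.μₗ_naturality_left_assoc,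
    Functor.LaxLeftLinear.μₗ_associativity_assoc]

end Bialgebra

/-- In the square `ξ_extendHom` the two `extendHom` sides are invertible by the antipode and the ξ
side at H_triv by triviality of the coaction, which leaves ξ_{H,C}. -/
theorem isIso_ξ {k : Type u} [Field k] {H : Type u} [Ring H] [HopfAlgebra k H]
    {C D : ModCoalg k H} (F : LaxModFunctor C D) (X : RComod k H) (M : RComod k C.carrier) :
    IsIso (F.ξ X M) := by
  refine F.isIso_ξ_of_regular ?_ X M
  have h1 := isIso_extendHom (actHom k H C.carrier) (actHom_assoc k H _) (actHom_unit k H _)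
  have h2 := isIso_extendHom F.regularAct F.regularAct_assoc F.regularAct_unit
  have h3 := F.isIso_ξ_triv H (regular k C.carrier)
  have h4 : IsIso (F.ξ (regular k H) (regular k C.carrier) ≫
      F.functor.map (extendHom (actHom k H C.carrier))) := by
    rw [F.ξ_extendHom]
    infer_instance
  exact IsIso.of_isIso_comp_right _ (F.functor.map (extendHom (actHom k H C.carrier)))

end LaxModFunctor

/-! ### The inclusion is an equivalence exactly through strength -/

section

variable {k : Type u} [Field k] {H : Type u} [Ring H]

theorem isEquivalence_inclusion_of_hasAntipode [B : Bialgebra k H] (h : HasAntipode k H)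
    (C D : ModCoalg k H) : (inclusion C D).IsEquivalence := by
  -- Substitution makes the ambient bialgebra structure literally the one underlying the Hopf
  -- algebra, so that `isIso_ξ` applies to the same module functors.
  obtain ⟨A, rfl⟩ := h
  have : (inclusion C D).EssSurj :=
    ⟨fun F => ⟨⟨F, fun X M => F.isIso_ξ X M⟩, ⟨Iso.refl _⟩⟩⟩
  exact { }

/-- Strength is invariant under isomorphism of module functors: compatibility with ξ exhibits ξ of
`F` as a conjugate of ξ of a strong functor. -/
theorem isStrong_of_isEquivalence [Bialgebra k H] {C D : ModCoalg k H}
    (h : (inclusion C D).IsEquivalence) (F : LaxModFunctor C D) : isStrong C D F := by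
  intro X M
  let G := (inclusion C D).objPreimage F
  let e : G.obj ≅ F := (inclusion C D).objObjPreimageIso F
  have hG : IsIso (G.obj.ξ X M) := G.property X M
  have hinv (N : RComod k C.carrier) : IsIso (e.hom.nat.app N) := by
    refine ⟨e.inv.nat.app N, ?_, ?_⟩
    · exact congrArg (fun f : LaxModFunctor.Hom G.obj G.obj => f.nat.app N) e.hom_inv_id
    · exact congrArg (fun f : LaxModFunctor.Hom F F => f.nat.app N) e.inv_hom_id
  have hcomm := e.hom.comm X M
  have : IsIso (X ⊴ₗ e.hom.nat.app M ≫ F.ξ X M) := by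
    rw [← hcomm]
    infer_instance
  exact IsIso.of_isIso_comp_left (X ⊴ₗ e.hom.nat.app M) _

end

/-! ### The tensor product of H-modules -/

section DiagAct

variable {k : Type u} [Field k] {H : Type u} [Ring H] [Bialgebra k H]
  {L M N P : Type u} [AddCommGroup L] [Module k L] [AddCommGroup M] [Module k M]
  [AddCommGroup N] [Module k N] [AddCommGroup P] [Module k P]
  (a : H ⊗[k] L →ₗ[k] L) (b : H ⊗[k] M →ₗ[k] M) (c : H ⊗[k] N →ₗ[k] N) (d : H ⊗[k] P →ₗ[k] P)

theorem diagAct_tmul (h : H) (t : L ⊗[k] M) : diagAct a b (h ⊗ₜ t) =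
    TensorProduct.map a b (TensorProduct.tensorTensorTensorComm k H H L M
      (Coalgebra.comul (R := k) h ⊗ₜ t)) := rfl

theorem rTensor_diagAct (f : L →ₗ[k] P) (hf : ∀ h l, f (a (h ⊗ₜ l)) = d (h ⊗ₜ f l))
    (h : H) (t : L ⊗[k] M) :
    f.rTensor M (diagAct a b (h ⊗ₜ t)) = diagAct d b (h ⊗ₜ f.rTensor M t) := by
  rw [diagAct_tmul, diagAct_tmul]
  generalize Coalgebra.comul (R := k) h = x
  induction x with
  | zero => simp
  | add x y hx hy => simp only [TensorProduct.add_tmul, map_add, hx, hy]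
  | tmul g g' =>
    induction t with
    | zero => simp
    | add x y hx hy => simp only [TensorProduct.tmul_add, map_add, hx, hy]
    | tmul l m => simp [hf]

theorem lTensor_diagAct (f : M →ₗ[k] P) (hf : ∀ h m, f (b (h ⊗ₜ m)) = d (h ⊗ₜ f m))
    (h : H) (t : L ⊗[k] M) :
    f.lTensor L (diagAct a b (h ⊗ₜ t)) = diagAct a d (h ⊗ₜ f.lTensor L t) := by
  rw [diagAct_tmul, diagAct_tmul]
  generalize Coalgebra.comul (R := k) h = x
  induction x with
  | zero => simp
  | add x y hx hy => simp only [TensorProduct.add_tmul, map_add, hx, hy]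
  | tmul g g' =>
    induction t with
    | zero => simp
    | add x y hx hy => simp only [TensorProduct.tmul_add, map_add, hx, hy]
    | tmul l m => simp [hf]

/-- Both sides let h₍₁₎, h₍₂₎, h₍₃₎ act on the three factors; coassociativity of H identifies the
two bracketings. -/
theorem assoc_diagAct (h : H) (t : (L ⊗[k] M) ⊗[k] N) :
    TensorProduct.assoc k L M N (diagAct (diagAct a b) c (h ⊗ₜ t)) =
      diagAct a (diagAct b c) (h ⊗ₜ TensorProduct.assoc k L M N t) := by
  induction t with
  | zero => simp
  | add x y hx hy => simp only [TensorProduct.tmul_add, map_add, hx, hy]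
  | tmul t n =>
    induction t with
    | zero => simp
    | add x y hx hy => simp only [TensorProduct.add_tmul, TensorProduct.tmul_add, map_add, hx, hy]
    | tmul l m =>
      let Ψ : H ⊗[k] (H ⊗[k] H) →ₗ[k] L ⊗[k] (M ⊗[k] N) :=
        TensorProduct.map (a ∘ₗ (TensorProduct.mk k H L).flip l)
          (TensorProduct.map (b ∘ₗ (TensorProduct.mk k H M).flip m)
            (c ∘ₗ (TensorProduct.mk k H N).flip n))
      have h1 : ∀ x : H ⊗[k] H, TensorProduct.assoc k L M N (TensorProduct.map (diagAct a b) c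
          (TensorProduct.tensorTensorTensorComm k H H (L ⊗[k] M) N
            (x ⊗ₜ ((l ⊗ₜ m) ⊗ₜ n)))) =
          Ψ (TensorProduct.assoc k H H H (Coalgebra.comul.rTensor H x)) := by
        intro x
        induction x with
        | zero => simp
        | add x y hx hy => simp only [TensorProduct.add_tmul, map_add, hx, hy]
        | tmul g g' =>
          rw [TensorProduct.tensorTensorTensorComm_tmul, TensorProduct.map_tmul, diagAct_tmul,
            LinearMap.rTensor_tmul]
          generalize Coalgebra.comul (R := k) g = y
          induction y with
          | zero => simp
          | add x y hx hy => simp only [TensorProduct.add_tmul, map_add, hx, hy]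
          | tmul g g' => simp [Ψ]
      have h2 : ∀ x : H ⊗[k] H, TensorProduct.map a (diagAct b c)
          (TensorProduct.tensorTensorTensorComm k H H L (M ⊗[k] N)
            (x ⊗ₜ (l ⊗ₜ (m ⊗ₜ n)))) = Ψ (Coalgebra.comul.lTensor H x) := by
        intro x
        induction x with
        | zero => simp
        | add x y hx hy => simp only [TensorProduct.add_tmul, map_add, hx, hy]
        | tmul g g' =>
          rw [TensorProduct.tensorTensorTensorComm_tmul, TensorProduct.map_tmul, diagAct_tmul,
            LinearMap.lTensor_tmul]
          generalize Coalgebra.comul (R := k) g' = y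
          induction y with
          | zero => simp
          | add x y hx hy =>
            simp only [TensorProduct.add_tmul, TensorProduct.tmul_add, map_add, hx, hy]
          | tmul g g' => simp [Ψ]
      rw [diagAct_tmul, h1, Coalgebra.coassoc_apply, ← h2, TensorProduct.assoc_tmul, diagAct_tmul]

theorem one_diagAct (ha : ∀ l, a (1 ⊗ₜ l) = l) (hb : ∀ m, b (1 ⊗ₜ m) = m) (t : L ⊗[k] M) :
    diagAct a b (1 ⊗ₜ t) = t := by
  rw [diagAct_tmul, Bialgebra.comul_one, Algebra.TensorProduct.one_def]
  induction t with
  | zero => simp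
  | add x y hx hy => simp only [TensorProduct.tmul_add, map_add, hx, hy]
  | tmul l m => simp [ha, hb]

theorem mul_diagAct (ha : ∀ g h l, a ((g * h) ⊗ₜ l) = a (g ⊗ₜ a (h ⊗ₜ l)))
    (hb : ∀ g h m, b ((g * h) ⊗ₜ m) = b (g ⊗ₜ b (h ⊗ₜ m))) (g h : H) (t : L ⊗[k] M) :
    diagAct a b ((g * h) ⊗ₜ t) = diagAct a b (g ⊗ₜ diagAct a b (h ⊗ₜ t)) := by
  simp only [diagAct_tmul]
  rw [Bialgebra.comul_mul]
  generalize Coalgebra.comul (R := k) g = x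
  generalize Coalgebra.comul (R := k) h = y
  induction t with
  | zero => simp
  | add x y hx hy => simp only [TensorProduct.tmul_add, map_add, hx, hy]
  | tmul l m =>
    induction x with
    | zero => simp
    | add x y hx hy => simp only [add_mul, TensorProduct.add_tmul, map_add, hx, hy]
    | tmul g g' =>
      induction y with
      | zero => simp
      | add x y hx hy =>
        simp only [mul_add, TensorProduct.add_tmul, TensorProduct.tmul_add, map_add, hx, hy]
      | tmul h h' => simp [ha, hb]

end DiagAct

/-! ### The bicomodule H ⊗ H -/

section LeftCofree

variable {k : Type u} [Field k] {C : Type u} [AddCommGroup C] [Module k C] [Coalgebra k C]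
  (V : Type u) [AddCommGroup V] [Module k V]

/-- The left coaction `Δ ⊗ id` on `C ⊗ V`. -/
def leftCofreeCoact : C ⊗[k] V →ₗ[k] C ⊗[k] (C ⊗[k] V) :=
  (TensorProduct.assoc k C C V).toLinearMap ∘ₗ (Coalgebra.comul (R := k) (A := C)).rTensor V

theorem leftCofreeCoact_coassoc (t : C ⊗[k] V) :
    TensorProduct.assoc k C C (C ⊗[k] V)
        ((Coalgebra.comul (R := k) (A := C)).rTensor (C ⊗[k] V) (leftCofreeCoact V t)) =
      (leftCofreeCoact V).lTensor C (leftCofreeCoact V t) := by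
  induction t with
  | zero => simp
  | add x y hx hy => simp only [map_add, hx, hy]
  | tmul c v =>
    have h1 : ∀ x : C ⊗[k] C, TensorProduct.assoc k C C (C ⊗[k] V)
        ((Coalgebra.comul (R := k) (A := C)).rTensor (C ⊗[k] V)
          (TensorProduct.assoc k C C V (x ⊗ₜ v))) =
        (TensorProduct.assoc k C C V).toLinearMap.lTensor C
          (TensorProduct.assoc k C (C ⊗[k] C) V
            (TensorProduct.assoc k C C C (Coalgebra.comul.rTensor C x) ⊗ₜ v)) := by
      intro x
      induction x with
      | zero => simp
      | add x y hx hy => simp only [TensorProduct.add_tmul, map_add, hx, hy]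
      | tmul a b =>
        simp only [TensorProduct.assoc_tmul, LinearMap.rTensor_tmul]
        generalize Coalgebra.comul (R := k) a = y
        induction y with
        | zero => simp
        | add x y hx hy => simp only [TensorProduct.add_tmul, map_add, hx, hy]
        | tmul a b => simp
    have h2 : ∀ x : C ⊗[k] C, (leftCofreeCoact V).lTensor C
          (TensorProduct.assoc k C C V (x ⊗ₜ v)) =
        (TensorProduct.assoc k C C V).toLinearMap.lTensor C
          (TensorProduct.assoc k C (C ⊗[k] C) V (Coalgebra.comul.lTensor C x ⊗ₜ v)) := by
      intro x
      induction x with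
      | zero => simp
      | add x y hx hy => simp only [TensorProduct.add_tmul, map_add, hx, hy]
      | tmul a b => simp [leftCofreeCoact]
    change TensorProduct.assoc k C C (C ⊗[k] V)
        ((Coalgebra.comul (R := k) (A := C)).rTensor (C ⊗[k] V)
          (TensorProduct.assoc k C C V (Coalgebra.comul c ⊗ₜ v))) =
      (leftCofreeCoact V).lTensor C (TensorProduct.assoc k C C V (Coalgebra.comul c ⊗ₜ v))
    rw [h1, h2, Coalgebra.coassoc_apply]

theorem leftCofreeCoact_counit (t : C ⊗[k] V) :
    TensorProduct.lid k (C ⊗[k] V) ((Coalgebra.counit (R := k) (A := C)).rTensor (C ⊗[k] V)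
      (leftCofreeCoact V t)) = t := by
  induction t with
  | zero => simp
  | add x y hx hy => simp only [map_add, hx, hy]
  | tmul c v =>
    have h1 : ∀ x : C ⊗[k] C, TensorProduct.lid k (C ⊗[k] V)
        ((Coalgebra.counit (R := k) (A := C)).rTensor (C ⊗[k] V)
          (TensorProduct.assoc k C C V (x ⊗ₜ v))) =
        TensorProduct.lid k C (Coalgebra.counit.rTensor C x) ⊗ₜ v := by
      intro x
      induction x with
      | zero => simp
      | add x y hx hy => simp only [TensorProduct.add_tmul, map_add, hx, hy]
      | tmul a b => simp [TensorProduct.smul_tmul']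
    refine (h1 (Coalgebra.comul c)).trans ?_
    simp

/-- The two coactions commute because they touch different tensor factors. -/
theorem leftCofreeCoact_comul {D : Type u} [AddCommGroup D] [Module k D] [Coalgebra k D]
    (t : C ⊗[k] D) :
    TensorProduct.assoc k C (C ⊗[k] D) D ((leftCofreeCoact D).rTensor D
        ((RComod.cofree (k := k) D C).coact t)) =
      (RComod.cofree (k := k) D C).coact.lTensor C (leftCofreeCoact D t) := by
  induction t with
  | zero => simp
  | add x y hx hy => simp only [map_add, hx, hy]
  | tmul c d =>
    let Ψ : (C ⊗[k] C) ⊗[k] (D ⊗[k] D) →ₗ[k] C ⊗[k] ((C ⊗[k] D) ⊗[k] D) :=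
      (TensorProduct.assoc k C D D).symm.toLinearMap.lTensor C ∘ₗ
        (TensorProduct.assoc k C C (D ⊗[k] D)).toLinearMap
    have h1 : ∀ y : D ⊗[k] D, TensorProduct.assoc k C (C ⊗[k] D) D
        ((leftCofreeCoact D).rTensor D ((TensorProduct.assoc k C D D).symm (c ⊗ₜ y))) =
        Ψ (Coalgebra.comul c ⊗ₜ y) := by
      intro y
      induction y with
      | zero => simp
      | add x y hx hy => simp only [TensorProduct.tmul_add, map_add, hx, hy]
      | tmul d d' =>
        simp only [leftCofreeCoact, TensorProduct.assoc_symm_tmul, LinearMap.rTensor_tmul,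
          LinearMap.comp_apply, LinearEquiv.coe_coe]
        generalize Coalgebra.comul (R := k) c = x
        induction x with
        | zero => simp
        | add x y hx hy => simp only [TensorProduct.add_tmul, map_add, hx, hy]
        | tmul a b => simp [Ψ]
    have h2 : ∀ x : C ⊗[k] C, (RComod.cofree (k := k) D C).coact.lTensor C
        (TensorProduct.assoc k C C D (x ⊗ₜ d)) = Ψ (x ⊗ₜ Coalgebra.comul d) := by
      intro x
      induction x with
      | zero => simp
      | add x y hx hy => simp only [TensorProduct.add_tmul, map_add, hx, hy]
      | tmul a b => simp [Ψ]
    exact (h1 _).trans (h2 _).symm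

end LeftCofree

section SelfBicomodule

variable (k : Type u) [Field k] (H : Type u) [Ring H] [Bialgebra k H]

/-- `H` as a module coalgebra over itself. -/
@[reducible]
def selfModCoalg : ModCoalg k H where
  carrier := H

/-- The right coaction is id ⊗ Δ. Both coactions are H-linear because Δ is an algebra map and the
associator of H-modules is H-linear. -/
theorem tensorIsBicomodule_self : TensorIsBicomodule (selfModCoalg k H) (selfModCoalg k H) := by
  refine ⟨(RComod.cofree (k := k) H H).coact, ?_⟩
  have h_one : ∀ h : H, actMap k H H (1 ⊗ₜ h) = h := fun h => one_mul h
  have h_mul : ∀ g h l : H, actMap k H H ((g * h) ⊗ₜ l) =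
      actMap k H H (g ⊗ₜ actMap k H H (h ⊗ₜ l)) := mul_assoc
  have h_comul : ∀ g h : H, Coalgebra.comul (R := k) (actMap k H H (g ⊗ₜ h)) =
      diagAct (actMap k H H) (actMap k H H) (g ⊗ₜ Coalgebra.comul (R := k) h) :=
    IsModuleCoalgebra.comul_smul
  exact
  { one_act := one_diagAct _ _ h_one h_one
    mul_act := mul_diagAct _ _ h_mul h_mul
    left_coassoc := leftCofreeCoact_coassoc H
    left_counit := leftCofreeCoact_counit H
    right_coassoc := (RComod.cofree (k := k) H H).coassoc
    right_counit := (RComod.cofree (k := k) H H).counit_coact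
    left_right := leftCofreeCoact_comul
    left_act := fun h m => by
      refine (congrArg (TensorProduct.assoc k H H H)
        (rTensor_diagAct _ _ _ Coalgebra.comul h_comul h m)).trans ?_
      exact assoc_diagAct _ _ _ h _
    right_act := fun h m => by
      refine (congrArg (TensorProduct.assoc k H H H).symm
        (lTensor_diagAct _ _ _ Coalgebra.comul h_comul h m)).trans ?_
      rw [LinearEquiv.symm_apply_eq, assoc_diagAct]
      congr 2
      exact ((TensorProduct.assoc k H H H).apply_symm_apply _).symm }

end SelfBicomodule

/-! ### A bijective Galois map gives an antipode -/

section Galois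

variable (k : Type u) [Field k] (H : Type u) [Ring H]

/-- The Galois map `x ⊗ h ↦ x₍₁₎ ⊗ x₍₂₎ h`. -/
def galoisMap [Bialgebra k H] : H ⊗[k] H →ₗ[k] H ⊗[k] H := comulExtend (LinearMap.mul' k H)

/-- The map `x ⊗ h ↦ x₍₁₎ ⊗ (x₍₂₎ ⊗ h)`. -/
def comulLeft [Bialgebra k H] : H ⊗[k] H →ₗ[k] H ⊗[k] (H ⊗[k] H) :=
  (TensorProduct.assoc k H H H).toLinearMap ∘ₗ (Coalgebra.comul (R := k) (A := H)).rTensor H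

variable {k H} [B : Bialgebra k H]

/-- Right H-linearity of the Galois map, inherited by its inverse. It yields one antipode axiom;
left colinearity, `comulLeft_galoisMap`, yields the other. -/
theorem galoisMap_lTensor_mulRight (h : H) (t : H ⊗[k] H) :
    galoisMap k H ((LinearMap.mulRight k h).lTensor H t) =
      (LinearMap.mulRight k h).lTensor H (galoisMap k H t) := by
  induction t with
  | zero => simp
  | add x y hx hy => simp only [map_add, hx, hy]
  | tmul x g =>
    simp only [galoisMap, comulExtend, LinearMap.comp_apply, LinearMap.rTensor_tmul,
      LinearMap.lTensor_tmul, LinearMap.mulRight_apply, LinearEquiv.coe_coe]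
    generalize Coalgebra.comul (R := k) x = y
    induction y with
    | zero => simp
    | add x y hx hy => simp only [TensorProduct.add_tmul, map_add, hx, hy]
    | tmul a b => simp [mul_assoc]

theorem comulLeft_galoisMap (t : H ⊗[k] H) :
    comulLeft k H (galoisMap k H t) = (galoisMap k H).lTensor H (comulLeft k H t) := by
  induction t with
  | zero => simp
  | add x y hx hy => simp only [map_add, hx, hy]
  | tmul x h =>
    let Ψ : H ⊗[k] (H ⊗[k] H) →ₗ[k] H ⊗[k] (H ⊗[k] H) :=
      ((LinearMap.mulRight k h).lTensor H).lTensor H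
    have h1 : ∀ y : H ⊗[k] H, comulLeft k H
        ((LinearMap.mul' k H).lTensor H (TensorProduct.assoc k H H H (y ⊗ₜ h))) =
        Ψ (TensorProduct.assoc k H H H (Coalgebra.comul.rTensor H y)) := by
      intro y
      induction y with
      | zero => simp
      | add x y hx hy => simp only [TensorProduct.add_tmul, map_add, hx, hy]
      | tmul a b =>
        simp only [comulLeft, TensorProduct.assoc_tmul, LinearMap.rTensor_tmul,
          LinearMap.lTensor_tmul, LinearMap.comp_apply, LinearEquiv.coe_coe]
        generalize Coalgebra.comul (R := k) a = z
        induction z with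
        | zero => simp
        | add x y hx hy => simp only [TensorProduct.add_tmul, map_add, hx, hy]
        | tmul c d => simp [Ψ]
    have h2 : ∀ y : H ⊗[k] H, (galoisMap k H).lTensor H (TensorProduct.assoc k H H H (y ⊗ₜ h)) =
        Ψ (Coalgebra.comul.lTensor H y) := by
      intro y
      induction y with
      | zero => simp
      | add x y hx hy => simp only [TensorProduct.add_tmul, map_add, hx, hy]
      | tmul a b =>
        simp only [galoisMap, comulExtend, TensorProduct.assoc_tmul, LinearMap.rTensor_tmul,
          LinearMap.lTensor_tmul, LinearMap.comp_apply, LinearEquiv.coe_coe]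
        generalize Coalgebra.comul (R := k) b = z
        induction z with
        | zero => simp
        | add x y hx hy =>
          simp only [TensorProduct.add_tmul, TensorProduct.tmul_add, map_add, hx, hy]
        | tmul c d => simp [Ψ]
    refine (h1 (Coalgebra.comul x)).trans ?_
    rw [Coalgebra.coassoc_apply, ← h2]
    rfl

/-- The map `x ⊗ h ↦ ε(x) h`. -/
def counitLeft (k H : Type u) [Field k] [Ring H] [Bialgebra k H] : H ⊗[k] H →ₗ[k] H :=
  (TensorProduct.lid k H).toLinearMap ∘ₗ (Coalgebra.counit (R := k) (A := H)).rTensor H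

theorem counitLeft_galoisMap (t : H ⊗[k] H) :
    counitLeft k H (galoisMap k H t) = LinearMap.mul' k H t := by
  induction t with
  | zero => simp
  | add x y hx hy => simp only [map_add, hx, hy]
  | tmul x h =>
    have h1 : ∀ y : H ⊗[k] H, counitLeft k H
        ((LinearMap.mul' k H).lTensor H (TensorProduct.assoc k H H H (y ⊗ₜ h))) =
        TensorProduct.lid k H (Coalgebra.counit.rTensor H y) * h := by
      intro y
      induction y with
      | zero => simp
      | add x y hx hy => simp only [TensorProduct.add_tmul, map_add, add_mul, hx, hy]
      | tmul a b => simp [counitLeft]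
    refine (h1 (Coalgebra.comul x)).trans ?_
    simp

theorem counitLeft_lTensor_mulRight (h : H) (t : H ⊗[k] H) :
    counitLeft k H ((LinearMap.mulRight k h).lTensor H t) = counitLeft k H t * h := by
  induction t with
  | zero => simp
  | add x y hx hy => simp only [map_add, add_mul, hx, hy]
  | tmul a b => simp [counitLeft]

theorem galoisMap_tmul_one (h : H) : galoisMap k H (h ⊗ₜ 1) = Coalgebra.comul h := by
  simp only [galoisMap, comulExtend, LinearMap.comp_apply, LinearMap.rTensor_tmul,
    LinearEquiv.coe_coe]
  generalize Coalgebra.comul (R := k) h = y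
  induction y with
  | zero => simp
  | add x y hx hy => simp only [TensorProduct.add_tmul, map_add, hx, hy]
  | tmul a b => simp

/-- A bialgebra with bijective Galois map is a Hopf algebra. -/
theorem hasAntipode_of_bijective (hg : Function.Bijective (galoisMap k H)) :
    HasAntipode k H := by
  let e := LinearEquiv.ofBijective (galoisMap k H) hg
  have he : ∀ t, galoisMap k H (e.symm t) = t := e.apply_symm_apply
  have he' : ∀ t, e.symm (galoisMap k H t) = t := e.symm_apply_apply
  -- In a Hopf algebra the inverse Galois map sends h ⊗ 1 to h₍₁₎ ⊗ S(h₍₂₎), so ε ⊗ id reads off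
  -- S(h).
  let S : H →ₗ[k] H := counitLeft k H ∘ₗ e.symm.toLinearMap ∘ₗ (TensorProduct.mk k H H).flip 1
  -- Right linearity of the inverse extends the definition of S from a ⊗ 1 to a ⊗ b. At t = Δ(h),
  -- the image of h ⊗ 1 under the Galois map, this gives S(h₍₁₎)h₍₂₎ = ε(h)1.
  have hr : ∀ t : H ⊗[k] H, LinearMap.mul' k H (S.rTensor H t) = counitLeft k H (e.symm t) := by
    intro t
    induction t with
    | zero => simp
    | add x y hx hy => simp only [map_add, hx, hy]
    | tmul a b =>
      have h1 : e.symm (a ⊗ₜ b) = (LinearMap.mulRight k b).lTensor H (e.symm (a ⊗ₜ 1)) := by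
        rw [LinearEquiv.symm_apply_eq]
        change _ = galoisMap k H _
        rw [galoisMap_lTensor_mulRight, he]
        simp
      rw [h1, counitLeft_lTensor_mulRight]
      rfl
  -- Left colinearity of the inverse moves it past Δ ⊗ id, after which the counit cancels Δ. Since
  -- multiplication is ε ⊗ id after the Galois map, this gives h₍₁₎S(h₍₂₎) = ε(h)1.
  have hl : ∀ h : H, S.lTensor H (Coalgebra.comul h) = e.symm (h ⊗ₜ 1) := by
    intro h
    have h1 : ((TensorProduct.mk k H H).flip 1).lTensor H (Coalgebra.comul h) =
        comulLeft k H (h ⊗ₜ 1) := by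
      simp only [comulLeft, LinearMap.comp_apply, LinearMap.rTensor_tmul, LinearEquiv.coe_coe]
      generalize Coalgebra.comul (R := k) h = y
      induction y with
      | zero => simp
      | add x y hx hy => simp only [TensorProduct.add_tmul, map_add, hx, hy]
      | tmul a b => simp
    have h2 : e.symm.toLinearMap.lTensor H (comulLeft k H (h ⊗ₜ 1)) =
        comulLeft k H (e.symm (h ⊗ₜ 1)) := by
      rw [← he (h ⊗ₜ 1), comulLeft_galoisMap, ← LinearMap.lTensor_comp_apply]
      have : e.symm.toLinearMap ∘ₗ galoisMap k H = LinearMap.id := LinearMap.ext he'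
      rw [this, he, LinearMap.lTensor_id, LinearMap.id_apply]
    have h3 : ∀ t, (counitLeft k H).lTensor H (comulLeft k H t) = t :=
      LinearMap.congr_fun comulExtend_counit
    rw [LinearMap.lTensor_comp_apply, LinearMap.lTensor_comp_apply, h1, h2, h3]
  refine ⟨{ B with
    antipode := S
    mul_antipode_rTensor_comul := ?_
    mul_antipode_lTensor_comul := ?_ }, rfl⟩
  · ext h
    refine (hr _).trans ?_
    rw [← galoisMap_tmul_one, he']
    simp [counitLeft, Algebra.algebraMap_eq_smul_one]
  · ext h
    change LinearMap.mul' k H (S.lTensor H (Coalgebra.comul h)) = _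
    rw [hl, ← counitLeft_galoisMap, he]
    simp [counitLeft, Algebra.algebraMap_eq_smul_one]

end Galois

/-! ### The coaction on M ⊗ H determined by s : C ⊗ H → H ⊗ D -/

section Twist

variable {k : Type u} [Field k] {H : Type u} [AddCommGroup H] [Module k H]
  {C : Type u} [AddCommGroup C] [Module k C]
  {D : Type u} [AddCommGroup D] [Module k D]
  {M : Type u} [AddCommGroup M] [Module k M]

/-- The projection `ε ⊗ id`. -/
def counitProj (k H C : Type u) [Field k] [AddCommGroup H] [Module k H] [AddCommGroup C]
    [Module k C] [Coalgebra k C] : C ⊗[k] H →ₗ[k] H :=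
  (TensorProduct.lid k H).toLinearMap ∘ₗ (Coalgebra.counit (R := k) (A := C)).rTensor H

/-- The map `m ⊗ h ↦ m₍₀₎ ⊗ (m₍₁₎ ⊗ h)`. -/
def expand (ρ : M →ₗ[k] M ⊗[k] C) : M ⊗[k] H →ₗ[k] M ⊗[k] (C ⊗[k] H) :=
  (TensorProduct.assoc k M C H).toLinearMap ∘ₗ ρ.rTensor H

/-- The coaction `m ⊗ h ↦ m₍₀₎ ⊗ s (m₍₁₎ ⊗ h)`. -/
def twistCoact (s : C ⊗[k] H →ₗ[k] H ⊗[k] D) (ρ : M →ₗ[k] M ⊗[k] C) :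
    M ⊗[k] H →ₗ[k] (M ⊗[k] H) ⊗[k] D :=
  (TensorProduct.assoc k M H D).symm.toLinearMap ∘ₗ s.lTensor M ∘ₗ expand ρ

theorem twistCoact_tmul (s : C ⊗[k] H →ₗ[k] H ⊗[k] D) (ρ : M →ₗ[k] M ⊗[k] C) (m : M) (h : H) :
    twistCoact s ρ (m ⊗ₜ h) = (TensorProduct.assoc k M H D).symm
      (s.lTensor M (TensorProduct.assoc k M C H (ρ m ⊗ₜ h))) := rfl

theorem twistCoact_natural {N : Type u} [AddCommGroup N] [Module k N]
    {s : C ⊗[k] H →ₗ[k] H ⊗[k] D} {ρ : M →ₗ[k] M ⊗[k] C} {ρ' : N →ₗ[k] N ⊗[k] C}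
    {f : M →ₗ[k] N} (hf : ∀ m, ρ' (f m) = f.rTensor C (ρ m)) (t : M ⊗[k] H) :
    twistCoact s ρ' (f.rTensor H t) = (f.rTensor H).rTensor D (twistCoact s ρ t) := by
  induction t with
  | zero => simp
  | add x y hx hy => simp only [map_add, hx, hy]
  | tmul m h =>
    rw [LinearMap.rTensor_tmul, twistCoact_tmul, twistCoact_tmul, hf]
    generalize ρ m = x
    induction x with
    | zero => simp
    | add x y hx hy => simp only [TensorProduct.add_tmul, map_add, hx, hy]
    | tmul m c =>
      simp only [TensorProduct.assoc_tmul, LinearMap.lTensor_tmul, LinearMap.rTensor_tmul]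
      generalize s (c ⊗ₜ h) = z
      induction z with
      | zero => simp
      | add x y hx hy => simp only [TensorProduct.tmul_add, map_add, hx, hy]
      | tmul h d => simp

variable [Coalgebra k C]

theorem counitProj_lTensor (t : C ⊗[k] H) :
    (counitProj k H C).lTensor C (leftCofreeCoact H t) = t := by
  induction t with
  | zero => simp
  | add x y hx hy => simp only [map_add, hx, hy]
  | tmul c h =>
    have h1 : ∀ x : C ⊗[k] C, (counitProj k H C).lTensor C (TensorProduct.assoc k C C H (x ⊗ₜ h)) =
        TensorProduct.rid k C (Coalgebra.counit.lTensor C x) ⊗ₜ h := by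
      intro x
      induction x with
      | zero => simp
      | add x y hx hy => simp only [TensorProduct.add_tmul, map_add, hx, hy]
      | tmul a b => simp [counitProj, TensorProduct.smul_tmul]
    refine (h1 (Coalgebra.comul c)).trans ?_
    simp

theorem counitProj_expand {ρ : M →ₗ[k] M ⊗[k] C}
    (hρ : ∀ m, TensorProduct.rid k M ((Coalgebra.counit (R := k) (A := C)).lTensor M (ρ m)) = m)
    (t : M ⊗[k] H) : (counitProj k H C).lTensor M (expand ρ t) = t := by
  induction t with
  | zero => simp
  | add x y hx hy => simp only [map_add, hx, hy]
  | tmul m h =>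
    have h1 : ∀ x : M ⊗[k] C, (counitProj k H C).lTensor M (TensorProduct.assoc k M C H (x ⊗ₜ h)) =
        TensorProduct.rid k M (Coalgebra.counit.lTensor M x) ⊗ₜ h := by
      intro x
      induction x with
      | zero => simp
      | add x y hx hy => simp only [TensorProduct.add_tmul, map_add, hx, hy]
      | tmul a b => simp [counitProj, TensorProduct.smul_tmul]
    refine (h1 (ρ m)).trans ?_
    rw [hρ]

/-- The coaction `m ⊗ n ↦ m₍₀₎ ⊗ (m₍₁₎ ⊗ n)` is coassociative. -/
theorem expand_coassoc {ρ : M →ₗ[k] M ⊗[k] C}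
    (hρ : ∀ m, TensorProduct.assoc k M C C (ρ.rTensor C (ρ m)) =
      (Coalgebra.comul (R := k) (A := C)).lTensor M (ρ m))
    (t : M ⊗[k] H) :
    expand ρ (expand ρ t) = (leftCofreeCoact H).lTensor M (expand ρ t) := by
  induction t with
  | zero => simp
  | add x y hx hy => simp only [map_add, hx, hy]
  | tmul m h =>
    let Ψ : M ⊗[k] (C ⊗[k] C) →ₗ[k] M ⊗[k] (C ⊗[k] (C ⊗[k] H)) :=
      ((TensorProduct.assoc k C C H).toLinearMap ∘ₗ
        (TensorProduct.mk k (C ⊗[k] C) H).flip h).lTensor M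
    have h1 : ∀ x : M ⊗[k] C, expand ρ (TensorProduct.assoc k M C H (x ⊗ₜ h)) =
        Ψ (TensorProduct.assoc k M C C (ρ.rTensor C x)) := by
      intro x
      induction x with
      | zero => simp
      | add x y hx hy => simp only [TensorProduct.add_tmul, map_add, hx, hy]
      | tmul a b =>
        simp only [expand, TensorProduct.assoc_tmul, LinearMap.rTensor_tmul, LinearMap.comp_apply,
          LinearEquiv.coe_coe]
        generalize ρ a = y
        induction y with
        | zero => simp
        | add x y hx hy => simp only [TensorProduct.add_tmul, map_add, hx, hy]
        | tmul a b => simp [Ψ]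
    have h2 : ∀ x : M ⊗[k] C, (leftCofreeCoact H).lTensor M
        (TensorProduct.assoc k M C H (x ⊗ₜ h)) = Ψ (Coalgebra.comul.lTensor M x) := by
      intro x
      induction x with
      | zero => simp
      | add x y hx hy => simp only [TensorProduct.add_tmul, map_add, hx, hy]
      | tmul a b => simp [Ψ, leftCofreeCoact]
    refine (h1 (ρ m)).trans ?_
    rw [hρ, ← h2]
    rfl

variable [Coalgebra k D] {s : C ⊗[k] H →ₗ[k] H ⊗[k] D} {ρ : M →ₗ[k] M ⊗[k] C}

theorem twistCoact_counit
    (hs : ∀ t, TensorProduct.rid k H ((Coalgebra.counit (R := k) (A := D)).lTensor H (s t)) =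
      counitProj k H C t)
    (hρ : ∀ m, TensorProduct.rid k M ((Coalgebra.counit (R := k) (A := C)).lTensor M (ρ m)) = m)
    (t : M ⊗[k] H) : TensorProduct.rid k (M ⊗[k] H)
      ((Coalgebra.counit (R := k) (A := D)).lTensor (M ⊗[k] H) (twistCoact s ρ t)) = t := by
  have h1 : ∀ y : M ⊗[k] (H ⊗[k] D), TensorProduct.rid k (M ⊗[k] H)
      ((Coalgebra.counit (R := k) (A := D)).lTensor (M ⊗[k] H)
        ((TensorProduct.assoc k M H D).symm y)) =
      ((TensorProduct.rid k H).toLinearMap ∘ₗ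
        (Coalgebra.counit (R := k) (A := D)).lTensor H).lTensor M y := by
    intro y
    induction y with
    | zero => simp
    | add x y hx hy => simp only [map_add, hx, hy]
    | tmul m y =>
      induction y with
      | zero => simp
      | add x y hx hy => simp only [TensorProduct.tmul_add, map_add, hx, hy]
      | tmul h d => simp
  refine (h1 _).trans ?_
  rw [LinearMap.comp_apply, ← LinearMap.lTensor_comp_apply]
  have h2 : ((TensorProduct.rid k H).toLinearMap ∘ₗ
      (Coalgebra.counit (R := k) (A := D)).lTensor H) ∘ₗ s = counitProj k H C :=
    LinearMap.ext hs
  rw [h2, counitProj_expand hρ]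

/-- The hypothesis `hs` is coassociativity on C ⊗ H after applying ε to C. Coassociativity of ρ, in
the form `expand_coassoc`, turns the general case into `hs` tensored with the identity of M. -/
theorem twistCoact_coassoc
    (hs : ∀ t, TensorProduct.assoc k H D D
      (s.rTensor D ((TensorProduct.assoc k C H D).symm (s.lTensor C (leftCofreeCoact H t)))) =
      (Coalgebra.comul (R := k) (A := D)).lTensor H (s t))
    (hρ : ∀ m, TensorProduct.assoc k M C C (ρ.rTensor C (ρ m)) =
      (Coalgebra.comul (R := k) (A := C)).lTensor M (ρ m))
    (t : M ⊗[k] H) : TensorProduct.assoc k (M ⊗[k] H) D D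
      ((twistCoact s ρ).rTensor D (twistCoact s ρ t)) =
      (Coalgebra.comul (R := k) (A := D)).lTensor (M ⊗[k] H) (twistCoact s ρ t) := by
  let σ : C ⊗[k] (H ⊗[k] D) →ₗ[k] H ⊗[k] (D ⊗[k] D) :=
    (TensorProduct.assoc k H D D).toLinearMap ∘ₗ s.rTensor D ∘ₗ
      (TensorProduct.assoc k C H D).symm.toLinearMap
  have h1 : ∀ y : M ⊗[k] (H ⊗[k] D), TensorProduct.assoc k (M ⊗[k] H) D D
      ((twistCoact s ρ).rTensor D ((TensorProduct.assoc k M H D).symm y)) =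
      (TensorProduct.assoc k M H (D ⊗[k] D)).symm (σ.lTensor M (expand ρ y)) := by
    intro y
    induction y with
    | zero => simp
    | add x y hx hy => simp only [map_add, hx, hy]
    | tmul m y =>
      induction y with
      | zero => simp
      | add x y hx hy => simp only [TensorProduct.tmul_add, map_add, hx, hy]
      | tmul h d =>
        simp only [expand, TensorProduct.assoc_symm_tmul, LinearMap.rTensor_tmul,
          LinearMap.comp_apply, LinearEquiv.coe_coe, twistCoact_tmul]
        generalize ρ m = x
        induction x with
        | zero => simp
        | add x y hx hy => simp only [TensorProduct.add_tmul, map_add, hx, hy]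
        | tmul m c =>
          simp only [TensorProduct.assoc_tmul, LinearMap.lTensor_tmul, σ, LinearMap.comp_apply,
            LinearEquiv.coe_coe, TensorProduct.assoc_symm_tmul, LinearMap.rTensor_tmul]
          generalize s (c ⊗ₜ h) = z
          induction z with
          | zero => simp
          | add x y hx hy =>
            simp only [TensorProduct.add_tmul, TensorProduct.tmul_add, map_add, hx, hy]
          | tmul h d => simp
  have h2 : ∀ z : M ⊗[k] (C ⊗[k] H), expand ρ (s.lTensor M z) =
      (s.lTensor C).lTensor M (expand ρ z) := by
    intro z
    induction z with
    | zero => simp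
    | add x y hx hy => simp only [map_add, hx, hy]
    | tmul m y =>
      simp only [expand, LinearMap.lTensor_tmul, LinearMap.rTensor_tmul, LinearMap.comp_apply,
        LinearEquiv.coe_coe]
      generalize ρ m = x
      induction x with
      | zero => simp
      | add x y hx hy => simp only [TensorProduct.add_tmul, map_add, hx, hy]
      | tmul m c => simp
  have h3 : ∀ y : M ⊗[k] (H ⊗[k] D), (Coalgebra.comul (R := k) (A := D)).lTensor (M ⊗[k] H)
      ((TensorProduct.assoc k M H D).symm y) =
      (TensorProduct.assoc k M H (D ⊗[k] D)).symm
        (((Coalgebra.comul (R := k) (A := D)).lTensor H).lTensor M y) := by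
    intro y
    induction y with
    | zero => simp
    | add x y hx hy => simp only [map_add, hx, hy]
    | tmul m y =>
      induction y with
      | zero => simp
      | add x y hx hy => simp only [TensorProduct.tmul_add, map_add, hx, hy]
      | tmul h d => simp
  have h4 : σ ∘ₗ s.lTensor C ∘ₗ leftCofreeCoact H =
      (Coalgebra.comul (R := k) (A := D)).lTensor H ∘ₗ s := LinearMap.ext hs
  refine (h1 _).trans (Eq.trans ?_ (h3 _).symm)
  rw [LinearMap.comp_apply, h2, expand_coassoc hρ,
    ← LinearMap.lTensor_comp_apply, ← LinearMap.lTensor_comp_apply, ← LinearMap.lTensor_comp_apply, LinearMap.comp_assoc, h4]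

end Twist

/-! ### The lax structure map x ⊗ (m ⊗ h) ↦ (x₍₀₎ ⊗ m) ⊗ x₍₁₎h -/

section Lineator

variable {k : Type u} [Field k] {H : Type u} [Ring H] [Bialgebra k H]
  {C : Type u} [AddCommGroup C] [Module k C]
  {D : Type u} [AddCommGroup D] [Module k D]
  {X M : Type u} [AddCommGroup X] [Module k X] [AddCommGroup M] [Module k M]

/-- The coaction of the tensor product, for arbitrary linear maps. -/
def mixedCoact (a : H ⊗[k] C →ₗ[k] C) (ρX : X →ₗ[k] X ⊗[k] H) (ρM : M →ₗ[k] M ⊗[k] C) :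
    X ⊗[k] M →ₗ[k] (X ⊗[k] M) ⊗[k] C :=
  a.lTensor (X ⊗[k] M) ∘ₗ (TensorProduct.tensorTensorTensorComm k X H M C).toLinearMap ∘ₗ
    TensorProduct.map ρX ρM

/-- The map `x ⊗ (m ⊗ h) ↦ (x₍₀₎ ⊗ m) ⊗ x₍₁₎ h`. -/
def lineator (M : Type u) [AddCommGroup M] [Module k M] (ρX : X →ₗ[k] X ⊗[k] H) :
    X ⊗[k] (M ⊗[k] H) →ₗ[k] (X ⊗[k] M) ⊗[k] H :=
  (actMap k H H).lTensor (X ⊗[k] M) ∘ₗ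
    (TensorProduct.tensorTensorTensorComm k X H M H).toLinearMap ∘ₗ ρX.rTensor (M ⊗[k] H)

theorem lineator_tmul (ρX : X →ₗ[k] X ⊗[k] H) (x : X) (m : M) (h : H) :
    lineator M ρX (x ⊗ₜ (m ⊗ₜ h)) = (actMap k H H).lTensor (X ⊗[k] M)
      (TensorProduct.tensorTensorTensorComm k X H M H (ρX x ⊗ₜ (m ⊗ₜ h))) := rfl

/-- Colinearity of the structure map. One side contains s(x₍₁₎m₍₁₎ ⊗ x₍₂₎h), the other the diagonal
action of x₍₁₎ ⊗ x₍₂₎ on s(m₍₁₎ ⊗ h); they agree by H-linearity of s, once coassociativity of X lets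
x₍₁₎ ⊗ x₍₂₎ be read as a comultiplication. -/
theorem twistCoact_lineator {a : H ⊗[k] C →ₗ[k] C} {d : H ⊗[k] D →ₗ[k] D}
    {s : C ⊗[k] H →ₗ[k] H ⊗[k] D}
    (hs : ∀ h t, s (diagAct a (actMap k H H) (h ⊗ₜ t)) = diagAct (actMap k H H) d (h ⊗ₜ s t))
    {ρX : X →ₗ[k] X ⊗[k] H} {ρM : M →ₗ[k] M ⊗[k] C}
    (hX : ∀ x, TensorProduct.assoc k X H H (ρX.rTensor H (ρX x)) =
      (Coalgebra.comul (R := k) (A := H)).lTensor X (ρX x))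
    (t : X ⊗[k] (M ⊗[k] H)) :
    twistCoact s (mixedCoact a ρX ρM) (lineator M ρX t) =
      (lineator M ρX).rTensor D (mixedCoact d ρX (twistCoact s ρM) t) := by
  suffices ∀ (x : X) (m : M) (h : H),
      twistCoact s (mixedCoact a ρX ρM) (lineator M ρX (x ⊗ₜ (m ⊗ₜ h))) =
      (lineator M ρX).rTensor D (mixedCoact d ρX (twistCoact s ρM) (x ⊗ₜ (m ⊗ₜ h))) by
    induction t with
    | zero => simp
    | add x y hx hy => simp only [map_add, hx, hy]
    | tmul x t =>
      induction t with
      | zero => simp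
      | add x y hx hy => simp only [TensorProduct.tmul_add, map_add, hx, hy]
      | tmul m h => exact this x m h
  intro x m h
  have h1 : ∀ (u : X ⊗[k] H), twistCoact s (mixedCoact a ρX ρM)
        ((actMap k H H).lTensor (X ⊗[k] M)
          (TensorProduct.tensorTensorTensorComm k X H M H (u ⊗ₜ (m ⊗ₜ h)))) =
      (TensorProduct.assoc k (X ⊗[k] M) H D).symm ((s ∘ₗ TensorProduct.map a (actMap k H H) ∘ₗ
        (TensorProduct.tensorTensorTensorComm k H H C H).toLinearMap).lTensor (X ⊗[k] M)
          (TensorProduct.tensorTensorTensorComm k X (H ⊗[k] H) M (C ⊗[k] H)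
            (TensorProduct.assoc k X H H (ρX.rTensor H u) ⊗ₜ
              TensorProduct.assoc k M C H (ρM m ⊗ₜ h)))) := by
    intro u
    induction u with
    | zero => simp
    | add x y hx hy => simp only [TensorProduct.add_tmul, map_add, hx, hy]
    | tmul x g =>
      simp only [TensorProduct.tensorTensorTensorComm_tmul, LinearMap.lTensor_tmul,
        twistCoact_tmul, mixedCoact, LinearMap.comp_apply, TensorProduct.map_tmul,
        LinearMap.rTensor_tmul, LinearEquiv.coe_coe]
      generalize ρX x = y
      generalize ρM m = z
      induction y with
      | zero => simp
      | add x y hx hy => simp only [TensorProduct.add_tmul, map_add, hx, hy]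
      | tmul x g' =>
        induction z with
        | zero => simp
        | add x y hx hy =>
          simp only [TensorProduct.add_tmul, TensorProduct.tmul_add, map_add, hx, hy]
        | tmul m c => simp
  have h2 : ∀ (u : X ⊗[k] H) (z : M ⊗[k] (C ⊗[k] H)), (s ∘ₗ TensorProduct.map a (actMap k H H) ∘ₗ
        (TensorProduct.tensorTensorTensorComm k H H C H).toLinearMap).lTensor (X ⊗[k] M)
          (TensorProduct.tensorTensorTensorComm k X (H ⊗[k] H) M (C ⊗[k] H)
            ((Coalgebra.comul (R := k) (A := H)).lTensor X u ⊗ₜ z)) =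
      (TensorProduct.map (actMap k H H) d ∘ₗ
        (TensorProduct.tensorTensorTensorComm k H H H D).toLinearMap).lTensor (X ⊗[k] M)
          (TensorProduct.tensorTensorTensorComm k X (H ⊗[k] H) M (H ⊗[k] D)
            ((Coalgebra.comul (R := k) (A := H)).lTensor X u ⊗ₜ s.lTensor M z)) := by
    intro u z
    induction u with
    | zero => simp
    | add x y hx hy => simp only [TensorProduct.add_tmul, map_add, hx, hy]
    | tmul x g =>
      induction z with
      | zero => simp
      | add x y hx hy => simp only [TensorProduct.tmul_add, map_add, hx, hy]
      | tmul m t =>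
        have := hs g t
        simp only [diagAct_tmul] at this
        simp [this]
  have h3 : ∀ (u : X ⊗[k] H) (z : M ⊗[k] (H ⊗[k] D)), (lineator M ρX).rTensor D
        (d.lTensor (X ⊗[k] (M ⊗[k] H))
          (TensorProduct.tensorTensorTensorComm k X H (M ⊗[k] H) D
            (u ⊗ₜ (TensorProduct.assoc k M H D).symm z))) =
      (TensorProduct.assoc k (X ⊗[k] M) H D).symm ((TensorProduct.map (actMap k H H) d ∘ₗ
        (TensorProduct.tensorTensorTensorComm k H H H D).toLinearMap).lTensor (X ⊗[k] M)
          (TensorProduct.tensorTensorTensorComm k X (H ⊗[k] H) M (H ⊗[k] D)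
            (TensorProduct.assoc k X H H (ρX.rTensor H u) ⊗ₜ z))) := by
    intro u z
    induction u with
    | zero => simp
    | add x y hx hy => simp only [TensorProduct.add_tmul, map_add, hx, hy]
    | tmul x g =>
      induction z with
      | zero => simp
      | add x y hx hy => simp only [TensorProduct.tmul_add, map_add, hx, hy]
      | tmul m t =>
        induction t with
        | zero => simp
        | add x y hx hy => simp only [TensorProduct.tmul_add, map_add, hx, hy]
        | tmul h' e =>
          simp only [TensorProduct.tensorTensorTensorComm_tmul, LinearMap.lTensor_tmul,
            TensorProduct.assoc_symm_tmul, LinearMap.rTensor_tmul, lineator_tmul]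
          generalize ρX x = y
          induction y with
          | zero => simp
          | add x y hx hy => simp only [TensorProduct.add_tmul, map_add, hx, hy]
          | tmul x g' => simp
  refine (h1 (ρX x)).trans (Eq.trans ?_ (h3 (ρX x) _).symm)
  rw [hX, h2]
  rfl

end Lineator

/-! ### The module functor of a bicomodule C ⊗ H, and the converse direction -/

section Bicomodule

variable {k : Type u} [Field k] {H : Type u} [Ring H] [Bialgebra k H] {C D : ModCoalg k H}

/-- The conditions on `s : C ⊗ H → H ⊗ D` equivalent to `c ⊗ h ↦ c₍₁₎ ⊗ s (c₍₂₎ ⊗ h)` making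
`C ⊗ H` a bicomodule in the category of `H`-modules. -/
structure IsTwist (C D : ModCoalg k H) (s : C.carrier ⊗[k] H →ₗ[k] H ⊗[k] D.carrier) : Prop where
  coassoc : ∀ t, TensorProduct.assoc k H D.carrier D.carrier (s.rTensor D.carrier
      ((TensorProduct.assoc k C.carrier H D.carrier).symm
        (s.lTensor C.carrier (leftCofreeCoact H t)))) =
    (Coalgebra.comul (R := k) (A := D.carrier)).lTensor H (s t)
  counit : ∀ t, TensorProduct.rid k H
    ((Coalgebra.counit (R := k) (A := D.carrier)).lTensor H (s t)) = counitProj k H C.carrier t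
  act : ∀ h t, s (diagAct (actMap k H C.carrier) (actMap k H H) (h ⊗ₜ t)) =
    diagAct (actMap k H H) (actMap k H D.carrier) (h ⊗ₜ s t)

theorem counitProj_diagAct (h : H) (t : C.carrier ⊗[k] H) :
    counitProj k H C.carrier (diagAct (actMap k H C.carrier) (actMap k H H) (h ⊗ₜ t)) =
      actMap k H H (h ⊗ₜ counitProj k H C.carrier t) := by
  rw [diagAct_tmul]
  induction t with
  | zero => simp
  | add x y hx hy => simp only [TensorProduct.tmul_add, map_add, hx, hy]
  | tmul c g =>
    have h1 : ∀ x : H ⊗[k] H, counitProj k H C.carrier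
        (TensorProduct.map (actMap k H C.carrier) (actMap k H H)
          (TensorProduct.tensorTensorTensorComm k H H C.carrier H (x ⊗ₜ (c ⊗ₜ g)))) =
        Coalgebra.counit (R := k) c •
          (TensorProduct.lid k H (Coalgebra.counit.rTensor H x) * g) := by
      intro x
      induction x with
      | zero => simp
      | add x y hx hy => simp only [TensorProduct.add_tmul, map_add, add_mul, smul_add, hx, hy]
      | tmul a b => simp [counitProj, IsModuleCoalgebra.counit_smul, smul_smul, mul_comm]
    rw [h1, Coalgebra.rTensor_counit_comul]
    simp [counitProj]

/-- The right coaction r is left C-colinear, and its target is left cofree on H ⊗ D, so r is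
determined by s = (ε ⊗ id ⊗ id) ∘ r. The axioms for r then project to those for s. -/
theorem exists_isTwist (h : TensorIsBicomodule C D) : ∃ s, IsTwist C D s := by
  obtain ⟨r, hr⟩ := h
  let s : C.carrier ⊗[k] H →ₗ[k] H ⊗[k] D.carrier :=
    (counitProj k H C.carrier).rTensor D.carrier ∘ₗ r
  -- Recovery of r from s: compatibility of the two coactions moves Δ ⊗ id past r, and ε then
  -- cancels it.
  have h1 : ∀ t, (TensorProduct.assoc k C.carrier H D.carrier).symm
        (s.lTensor C.carrier (leftCofreeCoact H t)) = r t := by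
    intro t
    have h2 : ∀ y : C.carrier ⊗[k] ((C.carrier ⊗[k] H) ⊗[k] D.carrier),
        (TensorProduct.assoc k C.carrier H D.carrier).symm
          (((counitProj k H C.carrier).rTensor D.carrier).lTensor C.carrier y) =
        ((counitProj k H C.carrier).lTensor C.carrier).rTensor D.carrier
          ((TensorProduct.assoc k C.carrier (C.carrier ⊗[k] H) D.carrier).symm y) := by
      intro y
      induction y with
      | zero => simp
      | add x y hx hy => simp only [map_add, hx, hy]
      | tmul c y =>
        induction y with
        | zero => simp
        | add x y hx hy => simp only [TensorProduct.tmul_add, map_add, hx, hy]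
        | tmul h d => simp
    have h3 : r.lTensor C.carrier (leftCofreeCoact H t) =
      TensorProduct.assoc k C.carrier (C.carrier ⊗[k] H) D.carrier
        ((leftCofreeCoact H).rTensor D.carrier (r t)) := (hr.left_right t).symm
    have h4 : (counitProj k H C.carrier).lTensor C.carrier ∘ₗ leftCofreeCoact H =
      LinearMap.id := LinearMap.ext counitProj_lTensor
    rw [LinearMap.lTensor_comp_apply, h2, h3, LinearEquiv.symm_apply_apply,
      ← LinearMap.rTensor_comp_apply, h4, LinearMap.rTensor_id, LinearMap.id_apply]
  refine ⟨s, ⟨fun t => ?_, fun t => ?_, fun h t => ?_⟩⟩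
  · have h2 : ∀ y : (C.carrier ⊗[k] H) ⊗[k] (D.carrier ⊗[k] D.carrier),
        TensorProduct.assoc k H D.carrier D.carrier
          (((counitProj k H C.carrier).rTensor D.carrier).rTensor D.carrier
            ((TensorProduct.assoc k (C.carrier ⊗[k] H) D.carrier D.carrier).symm y)) =
        (counitProj k H C.carrier).rTensor (D.carrier ⊗[k] D.carrier) y := by
      intro y
      induction y with
      | zero => simp
      | add x y hx hy => simp only [map_add, hx, hy]
      | tmul c y =>
        induction y with
        | zero => simp
        | add x y hx hy => simp only [TensorProduct.tmul_add, map_add, hx, hy]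
        | tmul h d => simp
    have h3 := hr.right_coassoc t
    rw [← LinearEquiv.eq_symm_apply] at h3
    rw [h1, LinearMap.rTensor_comp_apply, h3, h2, LinearMap.comp_apply,
      ← LinearMap.comp_apply (LinearMap.rTensor _ _), LinearMap.rTensor_comp_lTensor,
      ← LinearMap.comp_apply (LinearMap.lTensor _ _), LinearMap.lTensor_comp_rTensor]
  · have h2 : ∀ y : (C.carrier ⊗[k] H) ⊗[k] D.carrier, TensorProduct.rid k H
        ((Coalgebra.counit (R := k) (A := D.carrier)).lTensor H
          ((counitProj k H C.carrier).rTensor D.carrier y)) =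
        counitProj k H C.carrier (TensorProduct.rid k (C.carrier ⊗[k] H)
          ((Coalgebra.counit (R := k) (A := D.carrier)).lTensor (C.carrier ⊗[k] H) y)) := by
      intro y
      induction y with
      | zero => simp
      | add x y hx hy => simp only [map_add, hx, hy]
      | tmul c y => simp
    refine (h2 _).trans ?_
    rw [hr.right_counit]
  -- Both r and ε ⊗ id are H-linear, the latter because the counit of C is.
  · change (counitProj k H C.carrier).rTensor D.carrier (r _) = _
    rw [hr.right_act]
    exact rTensor_diagAct _ _ _ _ counitProj_diagAct h _

/-- The functor `M ↦ M ⊗ H`, the cotensor product with the bicomodule `C ⊗ H`. -/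
def twistFunctor {s : C.carrier ⊗[k] H →ₗ[k] H ⊗[k] D.carrier} (hs : IsTwist C D s) :
    RComod k C.carrier ⥤ RComod k D.carrier where
  obj M :=
    { carrier := M.carrier ⊗[k] H
      coact := twistCoact s M.coact
      coassoc := twistCoact_coassoc hs.coassoc M.coassoc
      counit_coact := twistCoact_counit hs.counit M.counit_coact }
  map f :=
    { lin := f.lin.rTensor H
      comm := twistCoact_natural f.comm }
  map_id _ := RComod.hom_ext (LinearMap.rTensor_id _ _)
  map_comp _ _ := RComod.hom_ext (LinearMap.rTensor_comp _ _ _)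

variable {s : C.carrier ⊗[k] H →ₗ[k] H ⊗[k] D.carrier} (hs : IsTwist C D s)

def twistFunctorForget : twistFunctor hs ⋙ RComod.forgetComod k D.carrier ≅
    RComod.forgetComod k C.carrier ⋙ tensorRight (ModuleCat.of k H) :=
  NatIso.ofComponents (fun M => Iso.refl (ModuleCat.of k (M.carrier ⊗[k] H))) (fun _ => rfl)

theorem twistFunctor_isTypeL : IsTypeL k (twistFunctor hs) where
  additive := ⟨RComod.hom_ext (LinearMap.rTensor_add _ _ _)⟩
  linear := ⟨fun _ _ => RComod.hom_ext (LinearMap.rTensor_smul _ _ _)⟩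
  preservesFiniteLimits := RComod.preservesFiniteLimits_of_forget _ _ (twistFunctorForget hs)
  preservesCoproducts _ := RComod.preservesColimitsOfShape_of_forget _ _ (twistFunctorForget hs)

theorem ext_lineator {X M Q : Type u} [AddCommGroup X] [Module k X] [AddCommGroup M] [Module k M]
    [AddCommGroup Q] [Module k Q] {f g : X ⊗[k] (M ⊗[k] H) →ₗ[k] Q}
    (h : ∀ x m h, f (x ⊗ₜ (m ⊗ₜ h)) = g (x ⊗ₜ (m ⊗ₜ h))) : f = g :=
  TensorProduct.ext (LinearMap.ext fun x => TensorProduct.ext' (h x))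

theorem lineator_natural_left {X Y M : Type u} [AddCommGroup X] [Module k X] [AddCommGroup Y]
    [Module k Y] [AddCommGroup M] [Module k M] {ρ : X →ₗ[k] X ⊗[k] H} {ρ' : Y →ₗ[k] Y ⊗[k] H}
    {f : X →ₗ[k] Y} (hf : ∀ x, ρ' (f x) = f.rTensor H (ρ x)) :
    lineator M ρ' ∘ₗ TensorProduct.map f LinearMap.id =
      (TensorProduct.map f LinearMap.id).rTensor H ∘ₗ lineator M ρ := by
  refine ext_lineator fun x m h => ?_
  simp only [LinearMap.comp_apply, TensorProduct.map_tmul, LinearMap.id_apply, lineator_tmul, hf]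
  generalize ρ x = u
  induction u with
  | zero => simp
  | add x y hx hy => simp only [TensorProduct.add_tmul, map_add, hx, hy]
  | tmul x g => simp

theorem lineator_natural_right {X M N : Type u} [AddCommGroup X] [Module k X] [AddCommGroup M]
    [Module k M] [AddCommGroup N] [Module k N] (ρ : X →ₗ[k] X ⊗[k] H) (f : M →ₗ[k] N) :
    lineator N ρ ∘ₗ TensorProduct.map LinearMap.id (f.rTensor H) =
      (TensorProduct.map LinearMap.id f).rTensor H ∘ₗ lineator M ρ := by
  refine ext_lineator fun x m h => ?_
  simp only [LinearMap.comp_apply, TensorProduct.map_tmul, LinearMap.id_apply, lineator_tmul,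
    LinearMap.rTensor_tmul]
  generalize ρ x = u
  induction u with
  | zero => simp
  | add x y hx hy => simp only [TensorProduct.add_tmul, map_add, hx, hy]
  | tmul x g => simp

theorem lineator_assoc {X Y M : Type u} [AddCommGroup X] [Module k X] [AddCommGroup Y]
    [Module k Y] [AddCommGroup M] [Module k M] (ρ : X →ₗ[k] X ⊗[k] H) (ρ' : Y →ₗ[k] Y ⊗[k] H) :
    (TensorProduct.assoc k X Y M).toLinearMap.rTensor H ∘ₗ
        lineator M (mixedCoact (actMap k H H) ρ ρ') =
      lineator (Y ⊗[k] M) ρ ∘ₗ TensorProduct.map LinearMap.id (lineator M ρ') ∘ₗ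
        (TensorProduct.assoc k X Y (M ⊗[k] H)).toLinearMap := by
  refine ext_lineator fun t m h => ?_
  induction t with
  | zero => simp
  | add x y hx hy => simp only [TensorProduct.add_tmul, map_add, hx, hy]
  | tmul x y =>
    simp only [LinearMap.comp_apply, LinearEquiv.coe_coe, TensorProduct.assoc_tmul,
      TensorProduct.map_tmul, LinearMap.id_apply, lineator_tmul, mixedCoact]
    generalize ρ' y = v
    induction v with
    | zero => simp
    | add x y hx hy =>
      simp only [TensorProduct.add_tmul, TensorProduct.tmul_add, map_add, hx, hy]
    | tmul y g =>
      simp only [TensorProduct.tensorTensorTensorComm_tmul, LinearMap.lTensor_tmul, lineator_tmul]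
      generalize ρ x = u
      induction u with
      | zero => simp
      | add x y hx hy => simp only [TensorProduct.add_tmul, map_add, hx, hy]
      | tmul x g => simp [mul_assoc]

/-- Associativity and unitality of the structure map come from those of multiplication in H. No
inverse is available in general, as inverting x₍₀₎ ⊗ x₍₁₎h calls for an antipode. -/
instance twistFunctorLax : (twistFunctor hs).LaxLeftLinear (RComod k H) where
  μₗ X M :=
    { lin := lineator M.carrier X.coact
      comm := twistCoact_lineator hs.act X.coassoc }
  μₗ_naturality_left f _ := RComod.hom_ext (lineator_natural_left f.comm)
  μₗ_naturality_right X _ _ f := RComod.hom_ext (lineator_natural_right X.coact f.lin)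
  μₗ_associativity X Y M := RComod.hom_ext (lineator_assoc X.coact Y.coact)
  μₗ_unitality M := RComod.hom_ext <| ext_lineator fun (r : k) m h => by
    change r • (m ⊗ₜ[k] h) = (r • m) ⊗ₜ[k] ((1 : H) * h)
    rw [one_mul, TensorProduct.smul_tmul']

/-- The lax module functor `M ↦ M ⊗ H`. -/
def twistModFunctor : LaxModFunctor C D where
  functor := twistFunctor hs
  isTypeL := twistFunctor_isTypeL hs

/-- A nonzero vector c and a functional f with f(c) = 1 make the Galois map a retract of the
structure map: J and J' insert c, P and P' evaluate f. The square with J, J' gives injectivity, the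
one with P, P' surjectivity. -/
theorem bijective_galoisMap_of_lineator {M : Type u} [AddCommGroup M] [Module k M] [Nontrivial M]
    (h : Function.Bijective (lineator M (Coalgebra.comul (R := k) (A := H)))) :
    Function.Bijective (galoisMap k H) := by
  obtain ⟨c, hc⟩ := exists_ne (0 : M)
  obtain ⟨f, hf⟩ := Module.Projective.exists_dual_eq_one k hc
  let Λ := lineator M (Coalgebra.comul (R := k) (A := H))
  let J : H ⊗[k] H →ₗ[k] H ⊗[k] (M ⊗[k] H) := (TensorProduct.mk k M H c).lTensor H
  let J' : H ⊗[k] H →ₗ[k] (H ⊗[k] M) ⊗[k] H := ((TensorProduct.mk k H M).flip c).rTensor H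
  let P : H ⊗[k] (M ⊗[k] H) →ₗ[k] H ⊗[k] H :=
    ((TensorProduct.lid k H).toLinearMap ∘ₗ f.rTensor H).lTensor H
  let P' : (H ⊗[k] M) ⊗[k] H →ₗ[k] H ⊗[k] H :=
    ((TensorProduct.rid k H).toLinearMap ∘ₗ f.lTensor H).rTensor H
  have hJ : Λ ∘ₗ J = J' ∘ₗ galoisMap k H := by
    refine TensorProduct.ext' fun x h => ?_
    simp only [LinearMap.comp_apply, J, LinearMap.lTensor_tmul, TensorProduct.mk_apply, Λ,
      lineator_tmul, galoisMap, comulExtend, LinearMap.rTensor_tmul, LinearEquiv.coe_coe]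
    generalize Coalgebra.comul (R := k) x = u
    induction u with
    | zero => simp
    | add x y hx hy => simp only [TensorProduct.add_tmul, map_add, hx, hy]
    | tmul x g => simp [J']
  have hP : P' ∘ₗ Λ = galoisMap k H ∘ₗ P := by
    refine ext_lineator fun x m h => ?_
    simp only [LinearMap.comp_apply, P, LinearMap.lTensor_tmul, Λ, TensorProduct.lid_tmul,
      lineator_tmul, galoisMap, comulExtend, LinearMap.rTensor_tmul, LinearEquiv.coe_coe]
    generalize Coalgebra.comul (R := k) x = u
    induction u with
    | zero => simp
    | add x y hx hy => simp only [TensorProduct.add_tmul, map_add, hx, hy]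
    | tmul x g => simp [P', TensorProduct.smul_tmul]
  have hPJ : P ∘ₗ J = LinearMap.id := TensorProduct.ext' fun x h => by simp [P, J, hf]
  have hPJ' : P' ∘ₗ J' = LinearMap.id := TensorProduct.ext' fun x h => by simp [P', J', hf]
  refine ⟨Function.Injective.of_comp (f := J') ?_, Function.Surjective.of_comp (g := P) ?_⟩
  · rw [← LinearMap.coe_comp, ← hJ, LinearMap.coe_comp]
    exact h.injective.comp (Function.LeftInverse.injective (LinearMap.congr_fun hPJ))
  · rw [← LinearMap.coe_comp, ← hP, LinearMap.coe_comp]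
    have hs : Function.Surjective P' :=
      Function.RightInverse.surjective (LinearMap.congr_fun hPJ')
    exact hs.comp h.surjective

theorem hasAntipode_of_isEquivalence (h : (inclusion C D).IsEquivalence)
    (hC : Nontrivial C.carrier) (hb : TensorIsBicomodule C D) : HasAntipode k H := by
  obtain ⟨s, hs⟩ := exists_isTwist hb
  have h1 : IsIso ((twistModFunctor hs).ξ (RComod.regular k H) (RComod.regular k C.carrier)) :=
    isStrong_of_isEquivalence h _ _ _
  refine hasAntipode_of_bijective (bijective_galoisMap_of_lineator (M := C.carrier) ?_)
  -- The linear map underlying ξ_{H,C} of this functor is the structure map with M = C and ρ = Δ.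
  have h2 := (asIso ((RComod.forgetComod k D.carrier).map ((twistModFunctor hs).ξ
    (RComod.regular k H) (RComod.regular k C.carrier)))).toLinearEquiv.bijective
  exact h2

end Bicomodule

end

end LaxStrong

theorem mainTheorem2 (k : Type u) [Field k] (H : Type u) [Ring H] [Bialgebra k H] :
    List.TFAE [
      LaxStrong.HasAntipode k H,
      ∀ C D : LaxStrong.ModCoalg k H, (LaxStrong.inclusion C D).IsEquivalence,
      ∃ C D : LaxStrong.ModCoalg k H, (LaxStrong.inclusion C D).IsEquivalence ∧
        Nontrivial C.carrier ∧ LaxStrong.TensorIsBicomodule C D] := by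
  tfae_have 1 → 2 := LaxStrong.isEquivalence_inclusion_of_hasAntipode
  tfae_have 2 → 3 := fun h =>
    ⟨LaxStrong.selfModCoalg k H, LaxStrong.selfModCoalg k H, h _ _,
      Bialgebra.nontrivial (R := k), LaxStrong.tensorIsBicomodule_self k H⟩
  tfae_have 3 → 1 := fun ⟨_, _, h, hC, hb⟩ => LaxStrong.hasAntipode_of_isEquivalence h hC hb
  tfae_finish
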